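/- Let $E/F$ be a quadratic Galois extension of non-Archimedean local fields, $x\mapsto\bar x$ the non-trivial element of $\mathrm{Gal}(E/F)$, $\mathfrak O_E$ the ring of integers of $E$, $k_E$ its residue field, and $\varpi_E$ a uniformizer of $E$. Let $n\ge 1$ and $$\mathrm U(n,n)=\{g\in \mathrm{GL}_{2n}(E)\mid {}^t\bar g J g=J\},\qquad J=\begin{bmatrix}0&1_n\\1_n&0\end{bmatrix},$$ $$L=\Big\{\begin{bmatrix}a&0\\0&{}^t\bar a^{-1}\end{bmatrix}\ \Big|\ a\in \mathrm{GL}_n(E)\Big\}\supset \mathfrak P_0=\Big\{\begin{bmatrix}a&0\\0&{}^t\bar a^{-1}\end{bmatrix}\ \Big|\ a\in \mathrm{GL}_n(\mathfrak O_E)\Big\},\qquad \zeta=\begin{bmatrix}\varpi_E 1_n&0\\0&\bar\varpi_E^{-1}1_n\end{bmatrix}\in L .$$ Let $Z(L)$ be the center of $L$. Let $\rho_0$ be the representation of $\mathfrak P_0\cong \mathrm{GL}_n(\mathfrak O_E)$ inflated from an irreducible cuspidal (finite-dimensional, complex) representation of $\mathrm{GL}_n(k_E)$ on a space $V$, and $\rho_0^\vee$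 its dual on $V^\vee$. Let $\mathcal H(L,\rho_0)$ be the space of compactly supported functions $f\colon L\to \mathrm{End}_{\mathbb C}(V^\vee)$ with $f(pxp')=\rho_0^\vee(p)f(x)\rho_0^\vee(p')$ for all $p,p'\in\mathfrak P_0$, $x\in L$. It is a $\mathbb C$-algebra under convolution $(f*g)(x)=\int_L f(y)g(y^{-1}x)\,dy$ with respect to the Haar measure on $L$ that gives $\mathfrak P_0$ volume $1$. An element $g\in L$ intertwines $\rho_0$ if $\mathrm{Hom}_{\mathfrak P_0\cap g\mathfrak P_0g^{-1}}(\rho_0^g,\rho_0)\ne 0$, where $\rho_0^g(x)=\rho_0(g^{-1}xg)$; let $\mathfrak I_L(\rho_0)$ be the set of such $g$. Then: 1. $\mathfrak I_L(\rho_0)=Z(L)\mathfrak P_0$. 2. If $\phi_1,\phi_2\in\mathcal H(L,\rho_0)$ and $z_1,z_2\in Z(L)$, $c_1,c_2\in\mathbb C$ satisfy $\mathrm{supp}(\phi_i)=\mathfrak P_0z_i$ and $\phi_i(z_i)=c_i1_{V^\vee}$ for $i=1,2$, then $(\phi_1*\phi_2)(z_1z_2)=\phi_1(z_1)\phi_2(z_2)=c_1c_2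 1_{V^\vee}$ and $\mathrm{supp}(\phi_1*\phi_2)=\mathfrak P_0z_1z_2$. 3. There is a unique $\alpha\in\mathcal H(L,\rho_0)$ with $\mathrm{supp}(\alpha)=\mathfrak P_0\zeta$ and $\alpha(\zeta)=1_{V^\vee}$. It is invertible, and for all $k\in\mathbb Z$, $\alpha^k(\zeta^k)=1_{V^\vee}$ and $\mathrm{supp}(\alpha^k)=\mathfrak P_0\zeta^k\mathfrak P_0=\mathfrak P_0\zeta^k=\zeta^k\mathfrak P_0$. 4. $\mathcal H(L,\rho_0)=\mathbb C[\alpha,\alpha^{-1}]$, that is, $\mathcal H(L,\rho_0)$ is generated as a $\mathbb C$-algebra by $\alpha$ and $\alpha^{-1}$. 5. There is a unique $\mathbb C$-algebra homomorphism $\mathbb C[x,x^{-1}]\to\mathcal H(L,\rho_0)=\mathbb C[\alpha,\alpha^{-1}]$ with $x\mapsto\alpha$, and it is an isomorphism. -/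

import Mathlib

open ValuativeRel MeasureTheory
open scoped Matrix MatrixGroups Pointwise LaurentPolynomial

noncomputable section

namespace SiegelLevi

section Hecke

set_option linter.unusedSectionVars false

/-- `K` is a compact open subgroup. -/
class IsCompactOpen {G : Type*} [Group G] [TopologicalSpace G] (K : Subgroup G) : Prop where
  isCompact : IsCompact (K : Set G)
  isOpen : IsOpen (K : Set G)

/-- The integral of a function with values in a finite-dimensional complex vector space, computed
in coordinates; by `apply_vecIntegral` the choice of basis is immaterial. -/
def vecIntegral {G W : Type*} [MeasurableSpace G] [AddCommGroup W] [Module ℂ W]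
    [FiniteDimensional ℂ W] (μ : Measure G) (φ : G → W) : W :=
  ∑ i, (∫ y, (Module.finBasis ℂ W).repr (φ y) i ∂μ) • Module.finBasis ℂ W i

lemma apply_vecIntegral {G W : Type*} [MeasurableSpace G] [AddCommGroup W] [Module ℂ W]
    [FiniteDimensional ℂ W] (μ : Measure G) (φ : G → W)
    (hφ : ∀ l : W →ₗ[ℂ] ℂ, Integrable (fun y => l (φ y)) μ) (l : W →ₗ[ℂ] ℂ) :
    l (vecIntegral μ φ) = ∫ y, l (φ y) ∂μ := by
  have h : ∀ y, l (φ y) = ∑ i, (Module.finBasis ℂ W).repr (φ y) i * l (Module.finBasis ℂ W i) := by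
    intro y
    conv_lhs => rw [← (Module.finBasis ℂ W).sum_repr (φ y), map_sum]
    simp only [map_smul, smul_eq_mul]
  simp_rw [h]
  rw [integral_finsetSum]
  · simp [vecIntegral, integral_mul_const]
  · intro i _
    exact (hφ ((Module.finBasis ℂ W).coord i)).mul_const _

variable {G : Type*} [Group G] [TopologicalSpace G]
  {V : Type*} [AddCommGroup V] [Module ℂ V]
  {W : Type*} [AddCommGroup W] [Module ℂ W]

/-- The space of compactly supported `f : G → End(V^∨)` with
`f(k₁ g k₂) = ρ^∨(k₁) f(g) ρ^∨(k₂)` for `k₁, k₂ ∈ K`. -/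
def heckeSpace (K : Subgroup G) (ρ : Representation ℂ K V) :
    Submodule ℂ (G → Module.End ℂ (Module.Dual ℂ V)) where
  carrier := {f | HasCompactSupport f ∧
    ∀ (k₁ k₂ : K) (g : G), f (k₁ * g * k₂) = ρ.dual k₁ * f g * ρ.dual k₂}
  zero_mem' := ⟨HasCompactSupport.zero, by simp⟩
  add_mem' := by
    rintro f g ⟨hf, hf'⟩ ⟨hg, hg'⟩
    exact ⟨hf.add hg, fun k₁ k₂ x => by simp [hf', hg', mul_add, add_mul]⟩
  smul_mem' := by
    rintro c f ⟨hf, hf'⟩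
    refine ⟨hf.mono fun x hx => ?_, fun k₁ k₂ x => by simp [hf']⟩
    intro h
    exact hx (by simp [h])

lemma heckeSpace_right {K : Subgroup G} {ρ : Representation ℂ K V}
    {f : G → Module.End ℂ (Module.Dual ℂ V)} (hf : f ∈ heckeSpace K ρ) (x : G) (k : K) :
    f (x * k) = f x * ρ.dual k := by
  have := hf.2 1 k x
  rwa [map_one, one_mul, OneMemClass.coe_one, one_mul] at this

lemma heckeSpace_left {K : Subgroup G} {ρ : Representation ℂ K V}
    {f : G → Module.End ℂ (Module.Dual ℂ V)} (hf : f ∈ heckeSpace K ρ) (x : G) (k : K) :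
    f (k * x) = ρ.dual k * f x := by
  have := hf.2 k 1 x
  rwa [map_one, mul_one, OneMemClass.coe_one, mul_one] at this

/-- Right `K`-invariant functions with compact support. -/
def Adm (K : Subgroup G) (φ : G → W) : Prop :=
  (∀ (x : G) (k : K), φ (x * k) = φ x) ∧ HasCompactSupport φ

/-- The sum of a right `K`-invariant function over `G / K`. -/
def cosetSum (K : Subgroup G) (φ : G → W) : W := ∑ᶠ q : G ⧸ K, φ q.out

lemma Adm.eq_of_mk {K : Subgroup G} {φ : G → W} (h : Adm K φ) {x y : G}
    (hxy : (x : G ⧸ K) = y) : φ x = φ y := by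
  have := h.1 x ⟨x⁻¹ * y, QuotientGroup.eq.mp hxy⟩
  simpa using this.symm

lemma Adm.out {K : Subgroup G} {φ : G → W} (h : Adm K φ) (x : G) :
    φ (x : G ⧸ K).out = φ x := h.eq_of_mk (QuotientGroup.out_eq' _)

lemma Adm.comp {K : Subgroup G} {φ : G → W} (h : Adm K φ) {W' : Type*} [AddCommGroup W']
    [Module ℂ W'] (l : W →ₗ[ℂ] W') : Adm K (fun x => l (φ x)) :=
  ⟨fun x k => by simp [h.1], h.2.comp_left (map_zero l)⟩

variable [IsTopologicalGroup G]

lemma Adm.finite {K : Subgroup G} [IsCompactOpen K] {φ : G → W} (h : Adm K φ) :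
    (Function.support fun q : G ⧸ K => φ q.out).Finite := by
  have : DiscreteTopology (G ⧸ K) := QuotientGroup.discreteTopology IsCompactOpen.isOpen
  have hc : IsCompact ((fun x : G => (x : G ⧸ K)) '' tsupport φ) :=
    IsCompact.image h.2 QuotientGroup.continuous_mk
  refine hc.finite_of_discrete.subset fun q hq => ⟨q.out, subset_tsupport _ hq, ?_⟩
  exact QuotientGroup.out_eq' _

lemma cosetSum_translate {K : Subgroup G} {φ : G → W} (h : Adm K φ) (a : G) :
    cosetSum K (fun x => φ (a * x)) = cosetSum K φ := by
  unfold cosetSum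
  rw [← finsum_comp_equiv (f := fun q : G ⧸ K => φ q.out)
    (MulAction.toPerm a : Equiv.Perm (G ⧸ K))]
  refine finsum_congr fun q => ?_
  refine h.eq_of_mk ?_
  rw [QuotientGroup.out_eq']
  change a • ((q.out : G) : G ⧸ K) = a • q
  rw [QuotientGroup.out_eq']

lemma cosetSum_add {K : Subgroup G} [IsCompactOpen K] {φ ψ : G → W} (h : Adm K φ) (h' : Adm K ψ) :
    cosetSum K (fun x => φ x + ψ x) = cosetSum K φ + cosetSum K ψ :=
  finsum_add_distrib h.finite h'.finite

lemma cosetSum_map {K : Subgroup G} [IsCompactOpen K] {φ : G → W} (h : Adm K φ)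
    {W' : Type*} [AddCommGroup W'] [Module ℂ W'] (l : W →ₗ[ℂ] W') :
    cosetSum K (fun x => l (φ x)) = l (cosetSum K φ) :=
  (map_finsum l h.finite).symm

lemma cosetSum_smul (K : Subgroup G) (c : ℂ) (φ : G → W) :
    (cosetSum K fun y => c • φ y) = c • cosetSum K φ :=
  (smul_finsum c fun q : G ⧸ K => φ q.out).symm

lemma cosetSum_comm {K : Subgroup G} {φ : G → G → W} (S T : Set (G ⧸ K))
    (hS : S.Finite) (hT : T.Finite)
    (h : ∀ x y : G, φ x y ≠ 0 → (x : G ⧸ K) ∈ S ∧ (y : G ⧸ K) ∈ T) :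
    cosetSum K (fun x => cosetSum K fun y => φ x y) =
      cosetSum K (fun y => cosetSum K fun x => φ x y) := by
  have hy : ∀ x, cosetSum K (fun y => φ x y) = ∑ r ∈ hT.toFinset, φ x r.out := fun x =>
    finsum_eq_sum_of_support_subset _ fun r hr => by simpa using (h _ _ hr).2
  have hx : ∀ y, cosetSum K (fun x => φ x y) = ∑ r ∈ hS.toFinset, φ r.out y := fun y =>
    finsum_eq_sum_of_support_subset _ fun r hr => by simpa using (h _ _ hr).1
  simp_rw [hx, hy]
  unfold cosetSum
  rw [finsum_eq_sum_of_support_subset (s := hS.toFinset),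
    finsum_eq_sum_of_support_subset (s := hT.toFinset), Finset.sum_comm]
  · intro r hr
    obtain ⟨q, -, hq⟩ := Finset.exists_ne_zero_of_sum_ne_zero hr
    simpa using (h _ _ hq).2
  · intro r hr
    obtain ⟨q, -, hq⟩ := Finset.exists_ne_zero_of_sum_ne_zero hr
    simpa using (h _ _ hq).1

section Measure

variable [MeasurableSpace G] [BorelSpace G] (μ : Measure G) [μ.IsHaarMeasure]

lemma measureReal_pos (K : Subgroup G) [IsCompactOpen K] : 0 < μ.real (K : Set G) := by
  have h1 : μ (K : Set G) ≠ ⊤ := (IsCompactOpen.isCompact (K := K)).measure_lt_top.ne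
  have h2 : 0 < μ (K : Set G) := (IsCompactOpen.isOpen (K := K)).measure_pos μ ⟨1, K.one_mem⟩
  exact ENNReal.toReal_pos h2.ne' h1

lemma adm_eq_sum {K : Subgroup G} [IsCompactOpen K] {φ : G → ℂ} (h : Adm K φ) :
    φ = fun x => ∑ q ∈ h.finite.toFinset,
      ((fun x : G => (x : G ⧸ K)) ⁻¹' {q}).indicator (fun _ => φ q.out) x := by
  funext x
  by_cases hx : φ x = 0
  · rw [hx, Finset.sum_eq_zero]
    intro q hq
    refine Set.indicator_of_notMem ?_ _
    rintro (rfl : (x : G ⧸ K) = q)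
    simp [h.out, hx] at hq
  · rw [Finset.sum_eq_single (x : G ⧸ K)]
    · rw [Set.indicator_of_mem (by simp), h.out]
    · intro q _ hq
      exact Set.indicator_of_notMem (fun h' => hq (by simpa using h'.symm)) _
    · intro hq
      simp [h.out, hx] at hq

lemma fiber_eq (K : Subgroup G) (q : G ⧸ K) :
    (fun x : G => (x : G ⧸ K)) ⁻¹' {q} = q.out • (K : Set G) := by
  ext x
  rw [Set.mem_smul_set_iff_inv_smul_mem]
  simp only [Set.mem_preimage, Set.mem_singleton_iff, smul_eq_mul, SetLike.mem_coe]
  rw [← QuotientGroup.eq, QuotientGroup.out_eq', eq_comm]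

lemma fiber_measurable (K : Subgroup G) [IsCompactOpen K] (q : G ⧸ K) :
    MeasurableSet ((fun x : G => (x : G ⧸ K)) ⁻¹' {q}) := by
  rw [fiber_eq]
  exact ((IsCompactOpen.isOpen (K := K)).smul _).measurableSet

lemma fiber_measure (K : Subgroup G) (q : G ⧸ K) :
    μ ((fun x : G => (x : G ⧸ K)) ⁻¹' {q}) = μ (K : Set G) := by
  rw [fiber_eq, measure_smul]

lemma integrable_fiber (K : Subgroup G) [IsCompactOpen K] (q : G ⧸ K) (c : ℂ) :
    Integrable (((fun x : G => (x : G ⧸ K)) ⁻¹' {q}).indicator (fun _ => c)) μ := by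
  rw [integrable_indicator_iff (fiber_measurable K q)]
  refine integrableOn_const ?_
  rw [fiber_measure]
  exact (IsCompactOpen.isCompact (K := K)).measure_lt_top.ne

lemma Adm.integrable {K : Subgroup G} [IsCompactOpen K] {φ : G → ℂ} (h : Adm K φ) :
    Integrable φ μ := by
  rw [adm_eq_sum h]
  exact integrable_finsetSum _ fun q _ => integrable_fiber μ K q _

lemma Adm.integral {K : Subgroup G} [IsCompactOpen K] {φ : G → ℂ} (h : Adm K φ) :
    ∫ x, φ x ∂μ = (μ.real (K : Set G) : ℂ) * cosetSum K φ := by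
  conv_lhs => rw [adm_eq_sum h]
  rw [integral_finsetSum _ fun q _ => integrable_fiber μ K q _]
  simp_rw [integral_indicator_const _ (fiber_measurable K _)]
  simp_rw [Measure.real, fiber_measure]
  rw [← Finset.smul_sum, cosetSum, finsum_eq_sum_of_support_subset (s := h.finite.toFinset)]
  · simp
  · simp

lemma vecIntegral_eq [FiniteDimensional ℂ W] {K : Subgroup G} [IsCompactOpen K] {φ : G → W}
    (h : Adm K φ) : vecIntegral μ φ = (μ.real (K : Set G) : ℂ) • cosetSum K φ := by
  refine (Module.finBasis ℂ W).ext_elem fun i => ?_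
  change (Module.finBasis ℂ W).coord i _ = (Module.finBasis ℂ W).coord i _
  rw [apply_vecIntegral μ φ (fun l => (h.comp l).integrable μ), (h.comp _).integral μ, map_smul,
    cosetSum_map h, smul_eq_mul]

variable [FiniteDimensional ℂ V]

/-- The convolution `(f * g)(x) = ∫_G f(y) g(y⁻¹x) dμ(y)`. -/
def conv (f g : G → Module.End ℂ (Module.Dual ℂ V)) : G → Module.End ℂ (Module.Dual ℂ V) :=
  fun x => vecIntegral μ fun y => f y * g (y⁻¹ * x)

variable {μ} {K : Subgroup G} {ρ : Representation ℂ K V}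
  {f g h : G → Module.End ℂ (Module.Dual ℂ V)}

lemma adm_conv (hf : f ∈ heckeSpace K ρ) (hg : g ∈ heckeSpace K ρ) (x : G) :
    Adm K (fun y => f y * g (y⁻¹ * x)) := by
  refine ⟨fun y k => ?_, hf.1.mono fun y hy h0 => hy (by simp [h0])⟩
  beta_reduce
  rw [heckeSpace_right hf, mul_inv_rev, mul_assoc]
  have : g ((k : G)⁻¹ * y⁻¹ * x) = ρ.dual k⁻¹ * g (y⁻¹ * x) := by
    rw [← heckeSpace_left hg]; simp [mul_assoc]
  rw [this, ← mul_assoc (ρ.dual k), ← map_mul, mul_inv_cancel, map_one, one_mul]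

lemma conv_eq [IsCompactOpen K] (hf : f ∈ heckeSpace K ρ) (hg : g ∈ heckeSpace K ρ) (x : G) :
    conv μ f g x = (μ.real (K : Set G) : ℂ) • cosetSum K fun y => f y * g (y⁻¹ * x) :=
  vecIntegral_eq μ (adm_conv hf hg x)

lemma conv_mem [IsCompactOpen K] (hf : f ∈ heckeSpace K ρ) (hg : g ∈ heckeSpace K ρ) :
    conv μ f g ∈ heckeSpace K ρ := by
  constructor
  · refine HasCompactSupport.intro (K := tsupport f * tsupport g)
      (IsCompact.mul hf.1 hg.1) fun x hx => ?_
    rw [conv_eq hf hg, cosetSum, finsum_eq_zero_of_forall_eq_zero, smul_zero]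
    intro q
    by_contra h0
    have h1 : f q.out ≠ 0 := fun h => h0 (by simp [h])
    have h2 : g (q.out⁻¹ * x) ≠ 0 := fun h => h0 (by simp [h])
    exact hx ⟨_, subset_tsupport _ h1, _, subset_tsupport _ h2, by simp⟩
  · intro k₁ k₂ x
    rw [conv_eq hf hg, conv_eq hf hg, ← cosetSum_translate (adm_conv hf hg _) (k₁ : G),
      mul_smul_comm, smul_mul_assoc]
    congr 1
    have e := cosetSum_map (adm_conv hf hg x)
      ((LinearMap.mulLeft ℂ (ρ.dual k₁)).comp (LinearMap.mulRight ℂ (ρ.dual k₂)))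
    simp only [LinearMap.comp_apply, LinearMap.mulLeft_apply, LinearMap.mulRight_apply] at e
    rw [mul_assoc (ρ.dual k₁), ← e]
    congr 1
    funext y
    rw [heckeSpace_left hf, show ((k₁ : G) * y)⁻¹ * (k₁ * x * k₂) = (y⁻¹ * x) * k₂ by group,
      heckeSpace_right hg]
    simp only [mul_assoc]

lemma conv_assoc [IsCompactOpen K] (hf : f ∈ heckeSpace K ρ) (hg : g ∈ heckeSpace K ρ)
    (hh : h ∈ heckeSpace K ρ) : conv μ (conv μ f g) h = conv μ f (conv μ g h) := by
  funext x
  have hfg : conv μ f g ∈ heckeSpace K ρ := conv_mem hf hg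
  have hgh : conv μ g h ∈ heckeSpace K ρ := conv_mem hg hh
  rw [conv_eq hfg hh, conv_eq hf hgh]
  congr 1
  have e1 : ∀ y, conv μ f g y * h (y⁻¹ * x) = (μ.real (K : Set G) : ℂ) •
      cosetSum K fun z => f z * g (z⁻¹ * y) * h (y⁻¹ * x) := by
    intro y
    rw [conv_eq hf hg, smul_mul_assoc]
    congr 1
    exact (cosetSum_map (adm_conv hf hg y) (LinearMap.mulRight ℂ (h (y⁻¹ * x)))).symm
  have e2 : ∀ z, f z * conv μ g h (z⁻¹ * x) = (μ.real (K : Set G) : ℂ) •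
      cosetSum K fun y => f z * g (z⁻¹ * y) * h (y⁻¹ * x) := by
    intro z
    rw [conv_eq hg hh, mul_smul_comm]
    congr 1
    rw [← cosetSum_translate (adm_conv hg hh _) z⁻¹]
    have := cosetSum_map (K := K) (φ := fun y => g (z⁻¹ * y) * h ((z⁻¹ * y)⁻¹ * (z⁻¹ * x)))
      ?_ (LinearMap.mulLeft ℂ (f z))
    · rw [LinearMap.mulLeft_apply] at this
      rw [← this]
      congr 1
      funext y
      rw [LinearMap.mulLeft_apply, show (z⁻¹ * y)⁻¹ * (z⁻¹ * x) = y⁻¹ * x by group, mul_assoc]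
    · have a := adm_conv hg hh (z⁻¹ * x)
      refine ⟨fun y k => by beta_reduce; rw [← mul_assoc]; exact a.1 _ k, ?_⟩
      exact a.2.comp_homeomorph (Homeomorph.mulLeft z⁻¹)
  simp_rw [e1, e2]
  have key : (cosetSum K fun y => cosetSum K fun z => f z * g (z⁻¹ * y) * h (y⁻¹ * x)) =
      cosetSum K fun z => cosetSum K fun y => f z * g (z⁻¹ * y) * h (y⁻¹ * x) := by
    have : DiscreteTopology (G ⧸ K) := QuotientGroup.discreteTopology IsCompactOpen.isOpen
    have fin : ∀ C : Set G, IsCompact C → ((fun x : G => (x : G ⧸ K)) '' C).Finite := fun C hC =>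
      (hC.image QuotientGroup.continuous_mk).finite_of_discrete
    refine cosetSum_comm _ _ (fin _ (IsCompact.mul hf.1 hg.1)) (fin _ hf.1) fun y z h0 => ?_
    have h1 : f z ≠ 0 := fun h => h0 (by simp [h])
    have h2 : g (z⁻¹ * y) ≠ 0 := fun h => h0 (by simp [h])
    exact ⟨⟨y, ⟨z, subset_tsupport _ h1, _, subset_tsupport _ h2, by simp⟩, rfl⟩,
      ⟨z, subset_tsupport _ h1, rfl⟩⟩
  rw [cosetSum_smul, cosetSum_smul, key]

variable (μ) in
open Classical in
/-- The unit of the Hecke algebra: `k ↦ vol(K)⁻¹ ρ^∨(k)` on `K`, and `0` off `K`. -/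
def heckeOne (K : Subgroup G) (ρ : Representation ℂ K V) :
    G → Module.End ℂ (Module.Dual ℂ V) := fun x =>
  if hx : x ∈ K then (μ.real (K : Set G) : ℂ)⁻¹ • ρ.dual ⟨x, hx⟩ else 0

lemma heckeOne_mem (μ : Measure G) (K : Subgroup G) [IsCompactOpen K] (ρ : Representation ℂ K V) :
    heckeOne μ K ρ ∈ heckeSpace K ρ := by
  constructor
  · exact HasCompactSupport.intro (IsCompactOpen.isCompact (K := K)) fun x hx => by
      simp only [heckeOne]; exact dif_neg hx
  · intro k₁ k₂ x
    have iff : (k₁ : G) * x * k₂ ∈ K ↔ x ∈ K := by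
      rw [K.mul_mem_cancel_right k₂.2, K.mul_mem_cancel_left k₁.2]
    by_cases hx : x ∈ K
    · simp only [heckeOne]
      rw [dif_pos (iff.mpr hx), dif_pos hx, mul_smul_comm, smul_mul_assoc, ← map_mul, ← map_mul]
      rfl
    · simp only [heckeOne]
      rw [dif_neg (fun h => hx (iff.mp h)), dif_neg hx]
      simp

lemma one_conv [IsCompactOpen K] (hf : f ∈ heckeSpace K ρ) : conv μ (heckeOne μ K ρ) f = f := by
  funext x
  have hc : (μ.real (K : Set G) : ℂ) ≠ 0 := by exact_mod_cast (measureReal_pos μ K).ne'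
  have a := adm_conv (heckeOne_mem μ K ρ) hf x
  rw [conv_eq (heckeOne_mem μ K ρ) hf, cosetSum, finsum_eq_single _ ((1 : G) : G ⧸ K), a.out]
  · simp only [heckeOne]
    rw [dif_pos K.one_mem, smul_mul_assoc, smul_smul, mul_inv_cancel₀ hc, one_smul]
    change ρ.dual 1 * _ = _
    rw [map_one, one_mul, inv_one, one_mul]
  · intro q hq
    have : q.out ∉ K := fun h => hq <| by
      rw [← QuotientGroup.out_eq' q]
      exact (QuotientGroup.eq.mpr (by simpa using h)).symm
    simp only [heckeOne]
    rw [dif_neg this, zero_mul]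

lemma conv_one [IsCompactOpen K] (hf : f ∈ heckeSpace K ρ) : conv μ f (heckeOne μ K ρ) = f := by
  funext x
  have hc : (μ.real (K : Set G) : ℂ) ≠ 0 := by exact_mod_cast (measureReal_pos μ K).ne'
  have a := adm_conv hf (heckeOne_mem μ K ρ) x
  rw [conv_eq hf (heckeOne_mem μ K ρ), cosetSum, finsum_eq_single _ (x : G ⧸ K), a.out]
  · simp only [heckeOne]
    rw [dif_pos (by simp), mul_smul_comm, smul_smul, mul_inv_cancel₀ hc, one_smul]
    have : (⟨x⁻¹ * x, by simp⟩ : K) = 1 := by ext; simp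
    rw [this, map_one, mul_one]
  · intro q hq
    have : q.out⁻¹ * x ∉ K := fun h => hq <| by
      rw [← QuotientGroup.out_eq' q]
      exact QuotientGroup.eq.mpr h
    simp only [heckeOne]
    rw [dif_neg this, mul_zero]

lemma conv_add [IsCompactOpen K] (hf : f ∈ heckeSpace K ρ) (hg : g ∈ heckeSpace K ρ)
    (hh : h ∈ heckeSpace K ρ) : conv μ f (g + h) = conv μ f g + conv μ f h := by
  funext x
  rw [Pi.add_apply, conv_eq hf (add_mem hg hh), conv_eq hf hg, conv_eq hf hh, ← smul_add,
    ← cosetSum_add (adm_conv hf hg x) (adm_conv hf hh x)]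
  simp only [Pi.add_apply, mul_add]

lemma add_conv [IsCompactOpen K] (hf : f ∈ heckeSpace K ρ) (hg : g ∈ heckeSpace K ρ)
    (hh : h ∈ heckeSpace K ρ) : conv μ (f + g) h = conv μ f h + conv μ g h := by
  funext x
  rw [Pi.add_apply, conv_eq (add_mem hf hg) hh, conv_eq hf hh, conv_eq hg hh, ← smul_add,
    ← cosetSum_add (adm_conv hf hh x) (adm_conv hg hh x)]
  simp only [Pi.add_apply, add_mul]

lemma smul_conv [IsCompactOpen K] (c : ℂ) (hf : f ∈ heckeSpace K ρ) (hg : g ∈ heckeSpace K ρ) :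
    conv μ (c • f) g = c • conv μ f g := by
  funext x
  rw [Pi.smul_apply, conv_eq (Submodule.smul_mem _ c hf) hg, conv_eq hf hg, smul_comm c,
    ← cosetSum_smul]
  simp only [Pi.smul_apply, smul_mul_assoc]
  rw [cosetSum_smul, cosetSum_smul]

lemma conv_smul [IsCompactOpen K] (c : ℂ) (hf : f ∈ heckeSpace K ρ) (hg : g ∈ heckeSpace K ρ) :
    conv μ f (c • g) = c • conv μ f g := by
  funext x
  rw [Pi.smul_apply, conv_eq hf (Submodule.smul_mem _ c hg), conv_eq hf hg, smul_comm c,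
    ← cosetSum_smul]
  simp only [Pi.smul_apply, mul_smul_comm]
  rw [cosetSum_smul, cosetSum_smul]

end Measure

section Algebra

variable [MeasurableSpace G]

/-- The Hecke algebra `H(G, ρ)`; its multiplication is convolution with respect to `μ`. -/
def HeckeAlgebra (K : Subgroup G) (ρ : Representation ℂ K V) (_μ : Measure G) : Type _ :=
  heckeSpace K ρ

variable (K : Subgroup G) (ρ : Representation ℂ K V) (μ : Measure G)

instance : FunLike (HeckeAlgebra K ρ μ) G (Module.End ℂ (Module.Dual ℂ V)) where
  coe f := f.val
  coe_injective _ _ h := Subtype.ext h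

instance : AddCommGroup (HeckeAlgebra K ρ μ) := inferInstanceAs (AddCommGroup (heckeSpace K ρ))

instance : Module ℂ (HeckeAlgebra K ρ μ) := inferInstanceAs (Module ℂ (heckeSpace K ρ))

variable [BorelSpace G] [μ.IsHaarMeasure] [FiniteDimensional ℂ V] [IsCompactOpen K]

instance : Ring (HeckeAlgebra K ρ μ) :=
  { (inferInstance : AddCommGroup (HeckeAlgebra K ρ μ)) with
    mul := fun f g => ⟨conv μ f.val g.val, conv_mem f.2 g.2⟩
    one := ⟨heckeOne μ K ρ, heckeOne_mem μ K ρ⟩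
    left_distrib := fun f g h => Subtype.ext (conv_add f.2 g.2 h.2)
    right_distrib := fun f g h => Subtype.ext (add_conv f.2 g.2 h.2)
    zero_mul := fun f => Subtype.ext (by
      have := smul_conv (μ := μ) 0 (zero_mem (heckeSpace K ρ)) f.2
      rw [zero_smul, zero_smul] at this
      exact this)
    mul_zero := fun f => Subtype.ext (by
      have := conv_smul (μ := μ) 0 f.2 (zero_mem (heckeSpace K ρ))
      rw [zero_smul, zero_smul] at this
      exact this)
    mul_assoc := fun f g h => Subtype.ext (conv_assoc f.2 g.2 h.2)
    one_mul := fun f => Subtype.ext (one_conv f.2)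
    mul_one := fun f => Subtype.ext (conv_one f.2) }

instance : Algebra ℂ (HeckeAlgebra K ρ μ) :=
  Algebra.ofModule (fun c f g => Subtype.ext (smul_conv c f.2 g.2))
    (fun c f g => Subtype.ext (conv_smul c f.2 g.2))

lemma HeckeAlgebra.coe_mul (f g : HeckeAlgebra K ρ μ) : ⇑(f * g) = conv μ f g := rfl

lemma HeckeAlgebra.coe_one : ⇑(1 : HeckeAlgebra K ρ μ) = heckeOne μ K ρ := rfl

end Algebra

/-- `g` intertwines `ρ`: there is a nonzero `K ∩ gKg⁻¹`-map from `ρ^g` to `ρ`, where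
`ρ^g(x) = ρ(g⁻¹xg)` on `gKg⁻¹`. -/
def Intertwines (K : Subgroup G) (ρ : Representation ℂ K V) (g : G) : Prop :=
  ∃ T : V →ₗ[ℂ] V, T ≠ 0 ∧ ∀ (x : G) (hx : x ∈ K) (hx' : g⁻¹ * x * g ∈ K) (v : V),
    T (ρ ⟨g⁻¹ * x * g, hx'⟩ v) = ρ ⟨x, hx⟩ (T v)

end Hecke
section Cuspidal

/-- `u` lies in the unipotent radical of the standard maximal parabolic subgroup of `GL_n(k)`
of block type `(r, n - r)`. -/
def InUnipotentRadical {k : Type*} [Field k] {n : ℕ} (r : ℕ) (u : GL (Fin n) k) : Prop :=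
  ∀ i j : Fin n, ¬ (i.val < r ∧ r ≤ j.val) → u.val i j = (1 : Matrix (Fin n) (Fin n) k) i j

/-- Cuspidality: no nonzero vector is fixed by the unipotent radical of a proper parabolic
subgroup. Every such radical contains a conjugate of the radical of a standard maximal proper
parabolic subgroup, so these suffice. -/
def IsCuspidal {k : Type*} [Field k] {n : ℕ} {V : Type*} [AddCommGroup V] [Module ℂ V]
    (τ : Representation ℂ (GL (Fin n) k) V) : Prop :=
  ∀ r : ℕ, 0 < r → r < n → ∀ v : V,
    (∀ u : GL (Fin n) k, InUnipotentRadical r u → τ u v = v) → v = 0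

end Cuspidal

section Groups

variable {F E : Type*} [Field F] [Field E] [Algebra F E]

/-- The entrywise action of `σ` followed by transposition, `g ↦ ᵗḡ`. -/
def conjT {m : Type*} (σ : E ≃ₐ[F] E) (A : Matrix m m E) : Matrix m m E := (A.map σ)ᵀ

lemma conjT_mul {m : Type*} [Fintype m] (σ : E ≃ₐ[F] E) (A B : Matrix m m E) :
    conjT σ (A * B) = conjT σ B * conjT σ A := by
  simp only [conjT]
  rw [Matrix.map_mul, Matrix.transpose_mul]

lemma conjT_one {m : Type*} [Fintype m] [DecidableEq m] (σ : E ≃ₐ[F] E) :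
    conjT σ (1 : Matrix m m E) = 1 := by
  simp [conjT]

lemma algEquiv_sq [Algebra.IsQuadraticExtension F E] (σ : E ≃ₐ[F] E) (x : E) :
    σ (σ x) = x := by
  have h2 : Nat.card (E ≃ₐ[F] E) ≤ 2 := by
    have := AlgEquiv.card_le (F := F) (K := E)
    rwa [Algebra.IsQuadraticExtension.finrank_eq_two F E, ← Nat.card_eq_fintype_card] at this
  have h3 : σ ^ 2 = 1 := by
    have : orderOf σ ≤ 2 := (Nat.le_of_dvd Nat.card_pos (orderOf_dvd_natCard σ)).trans h2
    have h0 : 0 < orderOf σ := orderOf_pos σ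
    interval_cases h : orderOf σ
    · rw [orderOf_eq_one_iff] at h; simp [h]
    · rw [← h]; exact pow_orderOf_eq_one σ
  have := congrArg (fun s : E ≃ₐ[F] E => s x) h3
  simpa [pow_two] using this

lemma conjT_conjT {m : Type*} [Algebra.IsQuadraticExtension F E] (σ : E ≃ₐ[F] E)
    (A : Matrix m m E) : conjT σ (conjT σ A) = A := by
  ext i j
  simp [conjT, algEquiv_sq]

/-- The matrix `J` with blocks `0, 1, 1, 0`. -/
def formJ (E : Type*) [Field E] (n : ℕ) : Matrix (Fin n ⊕ Fin n) (Fin n ⊕ Fin n) E :=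
  Matrix.fromBlocks 0 1 1 0

/-- The unitary group `U(n,n) = {g ∈ GL_{2n}(E) | ᵗḡ J g = J}`. -/
def unitaryGp (n : ℕ) (σ : E ≃ₐ[F] E) : Subgroup (GL (Fin n ⊕ Fin n) E) where
  carrier := {g | conjT σ g.val * formJ E n * g.val = formJ E n}
  one_mem' := by simp [conjT_one]
  mul_mem' := by
    intro a b ha hb
    simp only [Set.mem_ofPred_eq, Units.val_mul, conjT_mul] at *
    calc _ = conjT σ b.val * (conjT σ a.val * formJ E n * a.val) * b.val := by
            simp only [mul_assoc]
      _ = _ := by rw [ha, hb]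
  inv_mem' := by
    intro a ha
    simp only [Set.mem_ofPred_eq] at *
    have h1 : a.val * (a⁻¹).val = 1 := by simp
    have h2 : conjT σ (a⁻¹).val * conjT σ a.val = 1 := by rw [← conjT_mul, h1, conjT_one]
    calc _ = conjT σ (a⁻¹).val * (conjT σ a.val * formJ E n * a.val) * (a⁻¹).val := by rw [ha]
      _ = (conjT σ (a⁻¹).val * conjT σ a.val) * formJ E n * (a.val * (a⁻¹).val) := by
            simp only [mul_assoc]
      _ = _ := by rw [h1, h2]; simp

/-- The element of `GL_{2n}(E)` with diagonal blocks `a` and `ᵗā⁻¹`. -/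
def leviGL (n : ℕ) (σ : E ≃ₐ[F] E) : GL (Fin n) E →* GL (Fin n ⊕ Fin n) E where
  toFun a :=
    { val := Matrix.fromBlocks a.val 0 0 (conjT σ (a⁻¹).val)
      inv := Matrix.fromBlocks (a⁻¹).val 0 0 (conjT σ a.val)
      val_inv := by
        simp only [Matrix.fromBlocks_multiply, ← conjT_mul, Units.mul_inv]
        simp [conjT_one]
      inv_val := by
        simp only [Matrix.fromBlocks_multiply, ← conjT_mul, Units.inv_mul]
        simp [conjT_one] }
  map_one' := by
    ext1
    simp [conjT_one]
  map_mul' a b := by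
    ext1
    simp [Matrix.fromBlocks_multiply, conjT_mul]

variable [Algebra.IsQuadraticExtension F E]

/-- The homomorphism `a ↦ diag(a, ᵗā⁻¹)` from `GL_n(E)` to `U(n,n)`. -/
def leviHom (n : ℕ) (σ : E ≃ₐ[F] E) : GL (Fin n) E →* unitaryGp n σ :=
  (leviGL n σ).codRestrict (unitaryGp n σ) (by
    intro a
    change conjT σ (Matrix.fromBlocks a.val 0 0 (conjT σ (a⁻¹).val)) * formJ E n *
      (Matrix.fromBlocks a.val 0 0 (conjT σ (a⁻¹).val)) = formJ E n
    have h : conjT σ (Matrix.fromBlocks a.val 0 0 (conjT σ (a⁻¹).val)) =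
        Matrix.fromBlocks (conjT σ a.val) 0 0 (a⁻¹).val := by
      conv_rhs => rw [← conjT_conjT σ (a⁻¹).val]
      simp only [conjT, Matrix.fromBlocks_map, Matrix.fromBlocks_transpose]
      simp
    rw [h]
    simp only [formJ, Matrix.fromBlocks_multiply]
    simp only [zero_mul, mul_zero, mul_one, zero_add, add_zero, ← conjT_mul,
      Units.inv_mul]
    simp [conjT_one])

lemma leviHom_injective (n : ℕ) (σ : E ≃ₐ[F] E) : Function.Injective (leviHom n σ) := by
  intro a b h
  have h1 := congrArg (fun g : unitaryGp n σ => (g.val.val).toBlocks₁₁) h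
  ext1
  exact h1

/-- The Siegel Levi component `L = {diag(a, ᵗā⁻¹) | a ∈ GL_n(E)}` of `U(n,n)`. -/
abbrev levi (n : ℕ) (σ : E ≃ₐ[F] E) : Subgroup (unitaryGp n σ) := (leviHom n σ).range

/-- The isomorphism `GL_n(E) ≅ L`, `a ↦ diag(a, ᵗā⁻¹)`. -/
def leviEquiv (n : ℕ) (σ : E ≃ₐ[F] E) : GL (Fin n) E ≃* levi n σ :=
  MonoidHom.ofInjective (leviHom_injective n σ)

variable [ValuativeRel E]

/-- The homomorphism `GL_n(𝔒_E) → L`, `a ↦ diag(a, ᵗā⁻¹)`. -/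
def intHom (n : ℕ) (σ : E ≃ₐ[F] E) : GL (Fin n) 𝒪[E] →* levi n σ :=
  (leviEquiv n σ).toMonoidHom.comp (Matrix.GeneralLinearGroup.map 𝒪[E].subtype)

lemma intHom_injective (n : ℕ) (σ : E ≃ₐ[F] E) : Function.Injective (intHom n σ) := by
  refine (leviEquiv n σ).injective.comp ?_
  intro a b h
  ext i j
  exact congrArg (fun g : GL (Fin n) E => g.val i j) h

/-- The subgroup `𝔓₀ = {diag(a, ᵗā⁻¹) | a ∈ GL_n(𝔒_E)}` of `L`. -/
def P0 (n : ℕ) (σ : E ≃ₐ[F] E) : Subgroup (levi n σ) := (intHom n σ).range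

/-- The reduction map `𝔓₀ ≅ GL_n(𝔒_E) → GL_n(k_E)`. -/
def reduction (n : ℕ) (σ : E ≃ₐ[F] E) : P0 n σ →* GL (Fin n) 𝓀[E] :=
  (Matrix.GeneralLinearGroup.map (IsLocalRing.residue 𝒪[E])).comp
    (MonoidHom.ofInjective (intHom_injective n σ)).symm.toMonoidHom

/-- The inflation to `𝔓₀` of a representation of `GL_n(k_E)`. -/
def inflate {V : Type*} [AddCommGroup V] [Module ℂ V] (n : ℕ) (σ : E ≃ₐ[F] E)
    (τ : Representation ℂ (GL (Fin n) 𝓀[E]) V) : Representation ℂ (P0 n σ) V :=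
  τ.comp (reduction n σ)

/-- The element `diag(ϖ 1_n, ϖ̄⁻¹ 1_n)` of `L`. -/
def zeta (n : ℕ) (σ : E ≃ₐ[F] E) (ϖ : Eˣ) : levi n σ :=
  leviEquiv n σ (Units.map (Matrix.scalar (Fin n)).toMonoidHom ϖ)

/-- `ϖ` is a uniformizer: a generator of the maximal ideal of `𝔒_E`. -/
def IsUniformizer (ϖ : Eˣ) : Prop :=
  ∃ p : 𝒪[E], Irreducible p ∧ (p : E) = ϖ

end Groups

section Local

lemma continuous_algebraMap_local {F E : Type*} [Field F] [Field E] [Algebra F E] 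
  [ValuativeRel E] [TopologicalSpace E] [IsNonarchimedeanLocalField E]
 [ValuativeRel F] [TopologicalSpace F] [IsNonarchimedeanLocalField F]
  [ValuativeExtension F E] : Continuous (algebraMap F E) := by
  have arch : MulArchimedean (ValueGroupWithZero E) :=
    ValuativeRel.isRankLeOne_iff_mulArchimedean.mp inferInstance
  refine continuous_of_continuousAt_zero (algebraMap F E) ?_
  rw [ContinuousAt, map_zero, 
    (IsValuativeTopology.hasBasis_nhds_zero' F).tendsto_iff (IsValuativeTopology.hasBasis_nhds_zero' E)]
  intro γ hγ
  obtain ⟨r, hr, hr1⟩ := Valuation.IsNontrivial.exists_lt_one (v := valuation F)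
  have h1 : valuation E (algebraMap F E r) < 1 := by
    rw [← ValuativeExtension.mapValueGroupWithZero_valuation, ← map_one (ValuativeExtension.mapValueGroupWithZero F E)]
    exact ValuativeExtension.mapValueGroupWithZero_strictMono hr1
  obtain ⟨k, hk⟩ := exists_pow_lt₀ h1 (Units.mk0 γ hγ)
  refine ⟨valuation F (r ^ k), by simpa using fun h => absurd h (by simpa using hr), fun x hx => ?_⟩
  have h2 := ValuativeExtension.mapValueGroupWithZero_strictMono (A := F) (B := E) hx
  simp only [ValuativeExtension.mapValueGroupWithZero_valuation, map_pow] at h2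
  exact h2.trans hk


lemma t2_of_local (E : Type*) [Field E] 
  [ValuativeRel E] [TopologicalSpace E] [IsNonarchimedeanLocalField E] : T2Space E := by
  let := IsTopologicalAddGroup.rightUniformSpace E
  have := isUniformAddGroup_of_addCommGroup (G := E)
  infer_instance

lemma continuous_algEquiv {F E : Type*} [Field F] [Field E] [Algebra F E] [Module.Finite F E]
  [ValuativeRel E] [TopologicalSpace E] [IsNonarchimedeanLocalField E]
 [ValuativeRel F] [TopologicalSpace F] [IsNonarchimedeanLocalField F]
  [ValuativeExtension F E] (σ : E ≃ₐ[F] E) : Continuous σ := by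
  have : ContinuousSMul F E := continuousSMul_of_algebraMap F E continuous_algebraMap_local
  have : T2Space E := t2_of_local E
  let := IsTopologicalAddGroup.rightUniformSpace F
  have := isUniformAddGroup_of_addCommGroup (G := F)
  let : (Valued.v (R := F)).RankOne :=
  { hom' := (IsRankLeOne.nonempty (R := F)).some.emb.comp MonoidWithZeroHom.ValueGroup₀.embedding
    strictMono' := (IsRankLeOne.nonempty (R := F)).some.strictMono.comp
        MonoidWithZeroHom.ValueGroup₀.embedding_strictMono }
  have hc : CompleteSpace F := inferInstance
  let : NontriviallyNormedField F := Valued.toNontriviallyNormedField F (ValueGroupWithZero F)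
  have hc' : CompleteSpace F := hc
  exact LinearMap.continuous_of_finiteDimensional (𝕜 := F) σ.toLinearMap

end Local

section Topology

set_option linter.unusedSectionVars false

variable {F E : Type*} [Field F] [Field E] [Algebra F E] [Algebra.IsQuadraticExtension F E]
  [ValuativeRel E] [TopologicalSpace E] [IsNonarchimedeanLocalField E]

lemma mem_P0_iff (n : ℕ) (σ : E ≃ₐ[F] E) (g : levi n σ) :
    g ∈ P0 n σ ↔
      (∀ i j : Fin n, g.val.val.val (Sum.inl i) (Sum.inl j) ∈ 𝒪[E]) ∧
      (∀ i j : Fin n, (g⁻¹).val.val.val (Sum.inl i) (Sum.inl j) ∈ 𝒪[E]) := by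
  constructor
  · rintro ⟨a, rfl⟩
    refine ⟨fun i j => (a.val i j).2, fun i j => ?_⟩
    rw [← map_inv]
    exact ((a⁻¹).val i j).2
  · rintro ⟨h1, h2⟩
    obtain ⟨a, rfl⟩ := (leviEquiv n σ).surjective g
    rw [← map_inv] at h2
    have k1 : ∀ i j, a.val i j ∈ 𝒪[E] := h1
    have k2 : ∀ i j, (a⁻¹).val i j ∈ 𝒪[E] := h2
    have inj : Function.Injective
        (fun A : Matrix (Fin n) (Fin n) 𝒪[E] => 𝒪[E].subtype.mapMatrix A) := by
      intro A B h
      ext i j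
      exact congrArg (fun M : Matrix (Fin n) (Fin n) E => M i j) h
    refine ⟨⟨fun i j => ⟨a.val i j, k1 i j⟩, fun i j => ⟨(a⁻¹).val i j, k2 i j⟩, ?_, ?_⟩, ?_⟩
    · apply inj
      beta_reduce
      erw [RingHom.map_mul, RingHom.map_one]
      exact a.mul_inv
    · apply inj
      beta_reduce
      erw [RingHom.map_mul, RingHom.map_one]
      exact a.inv_mul
    · change leviEquiv n σ _ = _
      congr 1

lemma isOpen_P0 (n : ℕ) (σ : E ≃ₐ[F] E) :
    IsOpen (P0 n σ : Set (levi n σ)) := by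
  have hO : IsOpen (𝒪[E] : Set E) := Valuation.isOpen_integer (v := valuation E)
  have : (P0 n σ : Set (levi n σ)) =
      (⋂ i : Fin n, ⋂ j : Fin n,
        (fun g : levi n σ => g.val.val.val (Sum.inl i) (Sum.inl j)) ⁻¹' (𝒪[E] : Set E)) ∩
      (⋂ i : Fin n, ⋂ j : Fin n,
        (fun g : levi n σ => (g⁻¹).val.val.val (Sum.inl i) (Sum.inl j)) ⁻¹' (𝒪[E] : Set E)) := by
    ext g
    simp [mem_P0_iff]
  rw [this]
  have c : ∀ i j : Fin n, Continuous
      (fun g : levi n σ => g.val.val.val (Sum.inl i) (Sum.inl j)) := fun i j =>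
    (Units.continuous_val.comp
      (continuous_subtype_val.comp continuous_subtype_val)).matrix_elem _ _
  refine (isOpen_iInter_of_finite fun i => isOpen_iInter_of_finite fun j =>
    hO.preimage (c i j)).inter (isOpen_iInter_of_finite fun i => isOpen_iInter_of_finite fun j =>
    hO.preimage ((c i j).comp continuous_inv))

variable [ValuativeRel F] [TopologicalSpace F] [IsNonarchimedeanLocalField F]
  [ValuativeExtension F E]

lemma continuous_intHom (n : ℕ) (σ : E ≃ₐ[F] E) : Continuous (intHom n σ) := by
  have hs := continuous_algEquiv σ
  have c0 : Continuous (fun a : GL (Fin n) 𝒪[E] => a.val.map (Subtype.val : 𝒪[E] → E)) :=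
    Units.continuous_val.matrix_map continuous_subtype_val
  have c1 : Continuous (fun a : GL (Fin n) 𝒪[E] => (a⁻¹).val.map (Subtype.val : 𝒪[E] → E)) :=
    c0.comp continuous_inv
  refine Continuous.subtype_mk (Continuous.subtype_mk ?_ _) _
  refine Units.continuous_iff.mpr ⟨?_, ?_⟩
  · exact c0.matrix_fromBlocks continuous_const continuous_const
      (c1.matrix_map hs).matrix_transpose
  · exact c1.matrix_fromBlocks continuous_const continuous_const
      (c0.matrix_map hs).matrix_transpose

instance instIsCompactOpenP0 (n : ℕ) (σ : E ≃ₐ[F] E) : IsCompactOpen (P0 n σ) where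
  isOpen := isOpen_P0 n σ
  isCompact := by
    have := t2_of_local E
    have : CompactSpace (Matrix (Fin n) (Fin n) 𝒪[E]) :=
      inferInstanceAs (CompactSpace (Fin n → Fin n → 𝒪[E]))
    have h := isCompact_range (continuous_intHom n σ)
    rwa [← MonoidHom.coe_range] at h

end Topology

end SiegelLevi

end

/-! Identify `L` with `GL_n(E)`. Everything rests on the intertwining set, found here by a direct
argument (`Intertwines.exists_scalarElt_mul`). Dividing by an entry of maximal valuation, write `a =
cM` with `c` a scalar and `M` integral with reduction `M̄ ≠ 0`. If `M̄` is invertible, then `M ∈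
GL_n(𝔒_E)` and `a` lies in `Z(L)𝔓₀`. If not, take `u = 1 + M̄Y` with `YM̄ = 0`. For any lift of `Y`,
the identity `M(1 + YM) = (1 + MY)M` says that conjugation by `a⁻¹` carries a lift of `u` to an
element reducing to `1`. An intertwining operator `T` therefore satisfies `T v = τ(u) T v`. These
`u` form a conjugate of the unipotent radical of type `(r, n - r)`, `r = rank M̄`, `0 < r < n`, so
cuspidality gives `T = 0` (`IsCuspidal.eq_zero_of_fixed`).

A Hecke function `f` can be nonzero at `g` only if `g⁻¹` intertwines, because the transpose of
`f(g)` is an intertwining operator. Since `c` is a power of `ϖ` times a unit, the support of `f`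
lies in the disjoint union of the cosets `𝔓₀ζ^k`. It meets finitely many of them by compactness, and
`f(ζ^k)` is a scalar by Schur's lemma. The normalised functions on the cosets `𝔓₀z`, `z` central,
multiply like the `z` themselves because `𝔓₀` has volume `1` (`conv_centralFun`). Hence the powers
of `α` form a basis, and the algebra is the group algebra of `ℤ`. -/

noncomputable section

namespace SiegelLevi

/-! ### Hecke functions supported on one coset of a central element. -/

section CentralElements

set_option linter.unusedSectionVars false

variable {G : Type*} [Group G] [TopologicalSpace G] [IsTopologicalGroup G]
  {V : Type*} [AddCommGroup V] [Module ℂ V]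

open Classical in
/-- The function supported on `K z` with value `ρ^∨(k)` at `k z`. -/
def centralFun (K : Subgroup G) (ρ : Representation ℂ K V) (z : G) :
    G → Module.End ℂ (Module.Dual ℂ V) := fun x =>
  if h : x * z⁻¹ ∈ K then ρ.dual ⟨x * z⁻¹, h⟩ else 0

lemma centralFun_of_mem (K : Subgroup G) (ρ : Representation ℂ K V) {z x : G}
    (h : x * z⁻¹ ∈ K) : centralFun K ρ z x = ρ.dual ⟨x * z⁻¹, h⟩ := dif_pos h

lemma centralFun_of_notMem (K : Subgroup G) (ρ : Representation ℂ K V) {z x : G}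
    (h : x * z⁻¹ ∉ K) : centralFun K ρ z x = 0 := dif_neg h

/-- Only the quotient `x * z⁻¹` matters; this form avoids rewriting under the membership proof in
the definition. -/
lemma centralFun_congr (K : Subgroup G) (ρ : Representation ℂ K V) {z w x y : G}
    (h : x * z⁻¹ = y * w⁻¹) : centralFun K ρ z x = centralFun K ρ w y := by
  classical
  exact congrArg (fun g : G => if h : g ∈ K then ρ.dual ⟨g, h⟩ else 0) h

lemma centralFun_self (K : Subgroup G) (ρ : Representation ℂ K V) (z : G) :
    centralFun K ρ z z = 1 := by
  have h : z * z⁻¹ ∈ K := by simp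
  rw [centralFun_of_mem K ρ h]
  have : (⟨z * z⁻¹, h⟩ : K) = 1 := by ext; simp
  rw [this, map_one]

lemma mem_mul_singleton_iff {K : Subgroup G} {z x : G} :
    x ∈ (K : Set G) * {z} ↔ x * z⁻¹ ∈ K := by
  rw [Set.mul_singleton]
  constructor
  · rintro ⟨k, hk, rfl⟩
    simpa using hk
  · intro h
    exact ⟨_, h, by simp⟩

lemma isUnit_dual (K : Subgroup G) (ρ : Representation ℂ K V) (k : K) : IsUnit (ρ.dual k) :=
  (Group.isUnit k).map ρ.dual

lemma support_centralFun [Nontrivial (Module.Dual ℂ V)] (K : Subgroup G)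
    (ρ : Representation ℂ K V) (z : G) :
    Function.support (centralFun K ρ z) = (K : Set G) * {z} := by
  ext x
  rw [mem_mul_singleton_iff, Function.mem_support]
  by_cases h : x * z⁻¹ ∈ K
  · rw [centralFun_of_mem K ρ h]
    exact iff_of_true (isUnit_dual K ρ _).ne_zero h
  · exact iff_of_false (by simp [centralFun_of_notMem K ρ h]) h

/-- Left equivariance is built in; right equivariance holds because `k₂` commutes past the central
`z⁻¹`. -/
lemma centralFun_mem (K : Subgroup G) [IsCompactOpen K] (ρ : Representation ℂ K V) {z : G}
    (hz : z ∈ Subgroup.center G) : centralFun K ρ z ∈ heckeSpace K ρ := by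
  constructor
  · refine HasCompactSupport.intro
      ((IsCompactOpen.isCompact (K := K)).mul (isCompact_singleton (x := z))) fun x hx => ?_
    exact centralFun_of_notMem K ρ fun h => hx (mem_mul_singleton_iff.mpr h)
  · intro k₁ k₂ x
    have e : (k₁ : G) * x * k₂ * z⁻¹ = k₁ * (x * z⁻¹) * k₂ := by
      have := Subgroup.mem_center_iff.mp (inv_mem hz) (k₂ : G)
      rw [mul_assoc, this]
      simp only [mul_assoc]
    have iff : (k₁ : G) * x * k₂ * z⁻¹ ∈ K ↔ x * z⁻¹ ∈ K := by
      rw [e, K.mul_mem_cancel_right k₂.2, K.mul_mem_cancel_left k₁.2]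
    by_cases hx : x * z⁻¹ ∈ K
    · rw [centralFun_of_mem K ρ (iff.mpr hx), centralFun_of_mem K ρ hx, ← map_mul, ← map_mul]
      congr 1
      ext
      exact e
    · rw [centralFun_of_notMem K ρ (fun h => hx (iff.mp h)), centralFun_of_notMem K ρ hx]
      simp

lemma apply_eq_dual_mul {K : Subgroup G} {ρ : Representation ℂ K V}
    {f : G → Module.End ℂ (Module.Dual ℂ V)} (hf : f ∈ heckeSpace K ρ) {x z : G}
    (h : x * z⁻¹ ∈ K) : f x = ρ.dual ⟨x * z⁻¹, h⟩ * f z := by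
  rw [← heckeSpace_left hf]
  simp

/-- Left equivariance spreads the value at `z` over all of `Kz`. -/
lemma eq_smul_centralFun {K : Subgroup G} {ρ : Representation ℂ K V}
    {f : G → Module.End ℂ (Module.Dual ℂ V)} (hf : f ∈ heckeSpace K ρ) {z : G} {c : ℂ}
    (hs : Function.support f ⊆ (K : Set G) * {z}) (hc : f z = c • 1) :
    f = c • centralFun K ρ z := by
  funext x
  by_cases h : x * z⁻¹ ∈ K
  · rw [apply_eq_dual_mul hf h, hc, Pi.smul_apply, centralFun_of_mem K ρ h, mul_smul_comm, mul_one]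
  · rw [Pi.smul_apply, centralFun_of_notMem K ρ h, smul_zero]
    by_contra h0
    exact h (mem_mul_singleton_iff.mp (hs h0))

lemma mul_singleton_eq_singleton_mul {K : Subgroup G} {z : G} (hz : z ∈ Subgroup.center G) :
    (K : Set G) * {z} = {z} * (K : Set G) := by
  ext x
  rw [Set.mul_singleton, Set.singleton_mul]
  exact exists_congr fun k => and_congr_right fun _ => by
    beta_reduce
    rw [Subgroup.mem_center_iff.mp hz k]

lemma mul_singleton_mul_self {K : Subgroup G} {z : G} (hz : z ∈ Subgroup.center G) :
    (K : Set G) * {z} * (K : Set G) = (K : Set G) * {z} := by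
  rw [mul_assoc, ← mul_singleton_eq_singleton_mul hz, ← mul_assoc, coe_mul_coe]

variable [MeasurableSpace G] [BorelSpace G] (μ : Measure G) [μ.IsHaarMeasure]
  [FiniteDimensional ℂ V] (K : Subgroup G) [IsCompactOpen K] (ρ : Representation ℂ K V)

/-- The first factor vanishes off `Kz = zK`, so a single coset contributes to the sum over `G / K`,
and its weight is the volume `1` of `K`. -/
lemma conv_centralFun (hμ : μ (K : Set G) = 1) {z w : G} (hz : z ∈ Subgroup.center G)
    (hw : w ∈ Subgroup.center G) :
    conv μ (centralFun K ρ z) (centralFun K ρ w) = centralFun K ρ (z * w) := by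
  funext x
  have a := adm_conv (centralFun_mem K ρ hz) (centralFun_mem K ρ hw) x
  rw [conv_eq (centralFun_mem K ρ hz) (centralFun_mem K ρ hw), cosetSum,
    finsum_eq_single _ (z : G ⧸ K), a.out, Measure.real, hμ, centralFun_self]
  · have e : z⁻¹ * x * w⁻¹ = x * (z * w)⁻¹ := by
      rw [← Subgroup.mem_center_iff.mp (inv_mem hz) x, mul_inv_rev, mul_assoc,
        Subgroup.mem_center_iff.mp (inv_mem hw) z⁻¹]
    rw [centralFun_congr K ρ e]
    simp
  · intro q hq
    rw [centralFun_of_notMem, zero_mul]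
    intro h
    refine hq ?_
    rw [← QuotientGroup.out_eq' q]
    refine (QuotientGroup.eq.mpr ?_).symm
    rwa [← Subgroup.mem_center_iff.mp (inv_mem hz)]

/-- The elements `centralFun K ρ z`, multiplicative in the central element `z`. -/
def centralHom (hμ : μ (K : Set G) = 1) : Subgroup.center G →* HeckeAlgebra K ρ μ where
  toFun z := ⟨centralFun K ρ z, centralFun_mem K ρ z.2⟩
  map_one' := by
    refine Subtype.ext ?_
    change centralFun K ρ 1 = heckeOne μ K ρ
    funext x
    by_cases h : x ∈ K
    · rw [centralFun_of_mem K ρ (by simpa using h)]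
      simp only [heckeOne, Measure.real, hμ, dif_pos h]
      simp
    · rw [centralFun_of_notMem K ρ (by simpa using h)]
      simp only [heckeOne, dif_neg h]
  map_mul' z w := Subtype.ext (conv_centralFun μ K ρ hμ z.2 w.2).symm

lemma coe_centralHom (hμ : μ (K : Set G) = 1) (z : Subgroup.center G) :
    ⇑(centralHom μ K ρ hμ z) = centralFun K ρ z := rfl

lemma HeckeAlgebra.eq_smul_centralHom (hμ : μ (K : Set G) = 1) (f : HeckeAlgebra K ρ μ)
    (z : Subgroup.center G) {c : ℂ} (hs : Function.support f ⊆ (K : Set G) * {(z : G)})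
    (hc : f z = c • 1) : f = c • centralHom μ K ρ hμ z :=
  Subtype.ext (eq_smul_centralFun f.2 hs hc)

lemma HeckeAlgebra.smul_apply (c : ℂ) (f : HeckeAlgebra K ρ μ) (x : G) :
    (c • f) x = c • f x := rfl

lemma support_smul_centralFun [Nontrivial (Module.Dual ℂ V)] {c : ℂ} (hc : c ≠ 0) (z : G) :
    Function.support (c • centralFun K ρ z) = (K : Set G) * {z} := by
  rw [Function.support_const_smul_of_ne_zero _ _ hc, support_centralFun]

lemma mul_of_support_eq (hμ : μ (K : Set G) = 1) (φ₁ φ₂ : HeckeAlgebra K ρ μ) (z₁ z₂ : G)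
    (c₁ c₂ : ℂ) (h₁ : z₁ ∈ Subgroup.center G) (h₂ : z₂ ∈ Subgroup.center G)
    (s₁ : Function.support φ₁ = (K : Set G) * {z₁})
    (s₂ : Function.support φ₂ = (K : Set G) * {z₂})
    (e₁ : φ₁ z₁ = c₁ • 1) (e₂ : φ₂ z₂ = c₂ • 1) :
    (φ₁ * φ₂) (z₁ * z₂) = φ₁ z₁ * φ₂ z₂ ∧ (φ₁ * φ₂) (z₁ * z₂) = (c₁ * c₂) • 1 ∧
      Function.support (φ₁ * φ₂) = (K : Set G) * {z₁ * z₂} := by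
  -- The supports are exactly the cosets `K zᵢ`, which contain `zᵢ`. This forces `cᵢ ≠ 0`, needed
  -- for the support of the product, and also `V ≠ 0`.
  have n₁ : φ₁ z₁ ≠ 0 := by
    rw [← Function.mem_support, s₁, mem_mul_singleton_iff, mul_inv_cancel]
    exact K.one_mem
  have n₂ : φ₂ z₂ ≠ 0 := by
    rw [← Function.mem_support, s₂, mem_mul_singleton_iff, mul_inv_cancel]
    exact K.one_mem
  have d₁ : c₁ ≠ 0 := by rintro rfl; simp [e₁] at n₁
  have d₂ : c₂ ≠ 0 := by rintro rfl; simp [e₂] at n₂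
  have : Nontrivial (Module.Dual ℂ V) := by
    by_contra h
    rw [not_nontrivial_iff_subsingleton] at h
    exact n₁ (Subsingleton.elim _ _)
  have key : φ₁ * φ₂ = (c₁ * c₂) • centralHom μ K ρ hμ (⟨z₁, h₁⟩ * ⟨z₂, h₂⟩) := by
    rw [HeckeAlgebra.eq_smul_centralHom μ K ρ hμ φ₁ ⟨z₁, h₁⟩ s₁.le e₁,
      HeckeAlgebra.eq_smul_centralHom μ K ρ hμ φ₂ ⟨z₂, h₂⟩ s₂.le e₂, smul_mul_smul_comm, map_mul]
  have val : (φ₁ * φ₂) (z₁ * z₂) = (c₁ * c₂) • 1 := by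
    rw [key, HeckeAlgebra.smul_apply, coe_centralHom]
    change (c₁ * c₂) • centralFun K ρ (z₁ * z₂) (z₁ * z₂) = _
    rw [centralFun_self]
  refine ⟨?_, val, ?_⟩
  · rw [val, e₁, e₂, smul_mul_smul_comm, mul_one]
  · rw [key]
    exact support_smul_centralFun K ρ (mul_ne_zero d₁ d₂) _

end CentralElements

/-! ### Intertwining operators and the values of Hecke functions. -/

section Intertwining

variable {G : Type*} [Group G] {V : Type*} [AddCommGroup V] [Module ℂ V] {K : Subgroup G}
  {ρ : Representation ℂ K V}

/-- Conjugation by `z * p` is conjugation by `p`, so `ρ(p)` itself intertwines. -/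
lemma intertwines_mul [Nontrivial V] {z p : G} (hz : z ∈ Subgroup.center G) (hp : p ∈ K) :
    Intertwines K ρ (z * p) := by
  refine ⟨ρ ⟨p, hp⟩, ?_, fun x hx hx' v => ?_⟩
  · exact ((Group.isUnit (⟨p, hp⟩ : K)).map ρ).ne_zero
  · rw [← Module.End.mul_apply, ← Module.End.mul_apply, ← map_mul, ← map_mul]
    congr 2
    ext
    change p * ((z * p)⁻¹ * x * (z * p)) = x * p
    have := Subgroup.mem_center_iff.mp (inv_mem hz) x
    calc p * ((z * p)⁻¹ * x * (z * p)) = z⁻¹ * x * z * p := by group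
      _ = x * p := by rw [← this]; group

variable [FiniteDimensional ℂ V]

lemma exists_dualMap_eq (S : Module.End ℂ (Module.Dual ℂ V)) :
    ∃ T : V →ₗ[ℂ] V, S = T.dualMap := by
  refine ⟨(Module.evalEquiv ℂ V).symm.toLinearMap ∘ₗ S.dualMap ∘ₗ
    (Module.evalEquiv ℂ V).toLinearMap, ?_⟩
  ext φ v
  simp

variable [TopologicalSpace G]

/-- The two ways of computing `f(g x⁻¹) = f((g x g⁻¹)⁻¹ g)`, by right and by left equivariance, give
the relation after transposition. -/
lemma exists_transpose {f : G → Module.End ℂ (Module.Dual ℂ V)} (hf : f ∈ heckeSpace K ρ)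
    (g : G) : ∃ T : V →ₗ[ℂ] V, f g = T.dualMap ∧
      ∀ (x : G) (hx : x ∈ K) (hx' : g * x * g⁻¹ ∈ K) (v : V),
        T (ρ ⟨g * x * g⁻¹, hx'⟩ v) = ρ ⟨x, hx⟩ (T v) := by
  obtain ⟨T, hT⟩ := exists_dualMap_eq (f g)
  refine ⟨T, hT, fun x hx hx' v => ?_⟩
  -- Inverses are used since `ρ.dual k` is the transpose of `ρ k⁻¹`; they cancel in `h4`.
  have h1 := heckeSpace_right hf g ⟨x, hx⟩⁻¹
  have h2 := heckeSpace_left hf g ⟨g * x * g⁻¹, hx'⟩⁻¹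
  have e : g * x⁻¹ = (g * x * g⁻¹)⁻¹ * g := by group
  change f (g * x⁻¹) = _ at h1
  change f ((g * x * g⁻¹)⁻¹ * g) = _ at h2
  rw [e, h2, hT] at h1
  rw [← sub_eq_zero, ← Module.forall_dual_apply_eq_zero_iff ℂ]
  intro φ
  have h3 := congrArg (fun S : Module.End ℂ (Module.Dual ℂ V) => S φ v) h1
  have h4 : φ (T (ρ (⟨g * x * g⁻¹, hx'⟩ : K)⁻¹⁻¹ v)) = φ (ρ (⟨x, hx⟩ : K)⁻¹⁻¹ (T v)) := h3
  rw [inv_inv, inv_inv] at h4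
  rw [map_sub, sub_eq_zero, h4]

/-- The inverse appears because `f` takes values in endomorphisms of the dual, and transposition
exchanges the two sides. -/
lemma intertwines_inv_of_apply_ne_zero {f : G → Module.End ℂ (Module.Dual ℂ V)}
    (hf : f ∈ heckeSpace K ρ) {g : G} (h : f g ≠ 0) : Intertwines K ρ g⁻¹ := by
  obtain ⟨T, hT, hT'⟩ := exists_transpose hf g
  refine ⟨T, ?_, fun x hx hx' v => ?_⟩
  · rintro rfl
    exact h (by rw [hT]; ext; simp)
  · simp only [inv_inv] at hx' ⊢
    exact hT' x hx hx' v

/-- For central `z` the transpose of `f z` commutes with all of `ρ`, so the Schur property `hS`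
applies. -/
lemma apply_central_eq_smul (hS : ∀ T : V →ₗ[ℂ] V, (∀ k v, T (ρ k v) = ρ k (T v)) →
    ∃ c : ℂ, T = c • LinearMap.id) {f : G → Module.End ℂ (Module.Dual ℂ V)}
    (hf : f ∈ heckeSpace K ρ) {z : G} (hz : z ∈ Subgroup.center G) : ∃ c : ℂ, f z = c • 1 := by
  obtain ⟨T, hT, hT'⟩ := exists_transpose hf z
  obtain ⟨c, rfl⟩ := hS T fun k v => by
    have e : z * k * z⁻¹ = k := by rw [← Subgroup.mem_center_iff.mp hz k]; simp
    have := hT' k k.2 (by rw [e]; exact k.2) v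
    simpa only [e] using this
  exact ⟨c, by rw [hT]; ext; simp⟩

lemma exists_eq_smul_of_commute {Γ : Type*} [Group Γ] {τ : Representation ℂ Γ V}
    (hirr : τ.IsIrreducible) (T : V →ₗ[ℂ] V) (hT : ∀ g v, T (τ g v) = τ g (T v)) :
    ∃ c : ℂ, T = c • LinearMap.id := by
  let T' : Representation.IntertwiningMap τ τ := ⟨T, fun g => LinearMap.ext fun v => hT g v⟩
  obtain ⟨c, hc⟩ :=
    (Representation.IsIrreducible.algebraMap_intertwiningMap_bijective_of_isAlgClosed
      (k := ℂ) (ρ := τ)).2 T'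
  refine ⟨c, LinearMap.ext fun v => ?_⟩
  have := congrArg (fun S : Representation.IntertwiningMap τ τ => S v) hc
  exact this.symm

end Intertwining

/-! ### Powers of one central element and Laurent polynomials. -/

section Laurent

set_option linter.unusedSectionVars false

variable {G : Type*} [Group G] [TopologicalSpace G] [IsTopologicalGroup G]
  {V : Type*} [AddCommGroup V] [Module ℂ V]
  [MeasurableSpace G] [BorelSpace G] {μ : Measure G} [μ.IsHaarMeasure]
  [FiniteDimensional ℂ V] {K : Subgroup G} [IsCompactOpen K] {ρ : Representation ℂ K V}

/-- The unit of the Hecke algebra attached to a central element. -/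
def centralUnit (hμ : μ (K : Set G) = 1) (z : Subgroup.center G) : (HeckeAlgebra K ρ μ)ˣ :=
  (centralHom μ K ρ hμ).toHomUnits z

lemma coe_centralUnit_zpow (hμ : μ (K : Set G) = 1) (z : Subgroup.center G) (k : ℤ) :
    ⇑(centralUnit (ρ := ρ) hμ z ^ k).val = centralFun K ρ ((z : G) ^ k) := by
  rw [centralUnit, ← map_zpow]
  rfl

/-- A finite sum of functions supported on disjoint cosets of powers of `z`, at `z ^ m`. -/
lemma sum_smul_centralUnit_zpow_apply (hμ : μ (K : Set G) = 1) (z : Subgroup.center G)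
    (hz : ∀ k : ℤ, (z : G) ^ k ∈ K → k = 0) (p : ℤ →₀ ℂ) (x : G) (m : ℤ)
    (hx : x * ((z : G) ^ m)⁻¹ ∈ K) :
    (p.sum fun k c => c • (centralUnit (ρ := ρ) hμ z ^ k).val) x =
      p m • centralFun K ρ ((z : G) ^ m) x := by
  let ev : HeckeAlgebra K ρ μ →+ Module.End ℂ (Module.Dual ℂ V) :=
    { toFun := fun f => f x
      map_zero' := rfl
      map_add' := fun _ _ => rfl }
  change ev _ = _
  rw [Finsupp.sum, map_sum, Finset.sum_eq_single m]
  · change p m • (centralUnit (ρ := ρ) hμ z ^ m).val x = _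
    rw [coe_centralUnit_zpow]
  · intro k _ hk
    change p k • (centralUnit (ρ := ρ) hμ z ^ k).val x = 0
    rw [coe_centralUnit_zpow, centralFun_of_notMem, smul_zero]
    intro h
    -- If `x` lay in both `K z ^ k` and `K z ^ m`, then `z ^ (k - m)` would lie in `K`.
    refine hk (sub_eq_zero.mp (hz (k - m) ?_))
    have := K.mul_mem (K.inv_mem h) hx
    have e : (x * ((z : G) ^ k)⁻¹)⁻¹ * (x * ((z : G) ^ m)⁻¹) = (z : G) ^ (k - m) := by
      rw [zpow_sub]; group
    rwa [e] at this
  · intro hm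
    simp [ev, Finsupp.notMem_support_iff.mp hm]

/-- A compact set has finite image in the discrete space `G / K`, and distinct powers of `z` lie in
distinct cosets. -/
lemma finite_zpow_apply_ne_zero {f : G → Module.End ℂ (Module.Dual ℂ V)}
    (hf : HasCompactSupport f) {z : G} (hz : ∀ k : ℤ, z ^ k ∈ K → k = 0) :
    {k : ℤ | f (z ^ k) ≠ 0}.Finite := by
  have : DiscreteTopology (G ⧸ K) := QuotientGroup.discreteTopology IsCompactOpen.isOpen
  have hc : ((fun x : G => (x : G ⧸ K)) '' tsupport f).Finite :=
    (IsCompact.image hf QuotientGroup.continuous_mk).finite_of_discrete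
  refine Set.Finite.of_finite_image (f := fun k : ℤ => ((z ^ k : G) : G ⧸ K)) (hc.subset ?_) ?_
  · rintro _ ⟨k, hk, rfl⟩
    exact ⟨_, subset_tsupport _ hk, rfl⟩
  · intro k _ m _ h
    have h' := QuotientGroup.eq.mp h
    rw [← zpow_neg, ← zpow_add] at h'
    have := hz _ h'
    omega

/-- Every element of the Hecke algebra is a finite combination of powers of the unit attached to
`z`, when the intertwining elements lie in the cosets `K z ^ k`. -/
lemma exists_eq_sum_smul_zpow (hμ : μ (K : Set G) = 1) (z : Subgroup.center G)
    (hz : ∀ k : ℤ, (z : G) ^ k ∈ K → k = 0)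
    (hI : ∀ g, Intertwines K ρ g → ∃ k : ℤ, g * ((z : G) ^ k)⁻¹ ∈ K)
    (hS : ∀ T : V →ₗ[ℂ] V, (∀ k v, T (ρ k v) = ρ k (T v)) → ∃ c : ℂ, T = c • LinearMap.id)
    (f : HeckeAlgebra K ρ μ) :
    ∃ p : ℤ →₀ ℂ, f = p.sum fun k c => c • (centralUnit (ρ := ρ) hμ z ^ k).val := by
  have hc : ∀ k : ℤ, ∃ c : ℂ, f ((z : G) ^ k) = c • 1 := fun k =>
    apply_central_eq_smul hS f.2 (Subgroup.zpow_mem _ z.2 k)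
  -- The scalar is taken to be `0` wherever `f` vanishes, so that `c` has finite support even if `1
  -- = 0` in the endomorphism ring.
  have hc' : ∀ k : ℤ, ∃ c : ℂ, f ((z : G) ^ k) = c • 1 ∧ (f ((z : G) ^ k) = 0 → c = 0) := by
    intro k
    obtain ⟨c, h⟩ := hc k
    by_cases h0 : f ((z : G) ^ k) = 0
    · exact ⟨0, by simp [h0], fun _ => rfl⟩
    · exact ⟨c, h, fun h1 => absurd h1 h0⟩
  choose c hc1 hc2 using hc'
  have fin : (Function.support c).Finite :=
    (finite_zpow_apply_ne_zero (K := K) f.2.1 hz).subset fun k hk h0 => hk (hc2 k h0)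
  refine ⟨Finsupp.ofSupportFinite c fin, DFunLike.ext _ _ fun x => ?_⟩
  by_cases hx : ∃ m : ℤ, x * ((z : G) ^ m)⁻¹ ∈ K
  · obtain ⟨m, hm⟩ := hx
    rw [sum_smul_centralUnit_zpow_apply hμ z hz _ x m hm]
    have := apply_eq_dual_mul f.2 hm
    change f x = _ * f _ at this
    rw [this, hc1, centralFun_of_mem K ρ hm, mul_smul_comm, mul_one]
    rfl
  · have h0 : f x = 0 := by
      by_contra h0
      -- Here `x⁻¹ ∈ K z ^ k`; inverting and using centrality puts `x` in `K z ^ (-k)`.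
      obtain ⟨k, hk⟩ := hI _ (intertwines_inv_of_apply_ne_zero f.2 h0)
      refine hx ⟨-k, ?_⟩
      have e : (x⁻¹ * ((z : G) ^ k)⁻¹)⁻¹ = x * ((z : G) ^ (-k))⁻¹ := by
        rw [mul_inv_rev, inv_inv, inv_inv, zpow_neg, inv_inv]
        exact (Subgroup.mem_center_iff.mp (Subgroup.zpow_mem _ z.2 k) x).symm
      rw [← e]
      exact K.inv_mem hk
    let ev : HeckeAlgebra K ρ μ →+ Module.End ℂ (Module.Dual ℂ V) :=
      { toFun := fun f => f x
        map_zero' := rfl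
        map_add' := fun _ _ => rfl }
    rw [h0]
    symm
    change ev _ = 0
    rw [Finsupp.sum, map_sum]
    refine Finset.sum_eq_zero fun k _ => ?_
    change (_ : ℂ) • (centralUnit (ρ := ρ) hμ z ^ k).val x = 0
    rw [coe_centralUnit_zpow, centralFun_of_notMem K ρ (fun h => hx ⟨k, h⟩), smul_zero]

/-- Evaluation of Laurent polynomials at a unit of a not necessarily commutative algebra. -/
def laurentLift {A : Type*} [Ring A] [Algebra ℂ A] (a : Aˣ) : ℂ[T;T⁻¹] →ₐ[ℂ] A :=
  AddMonoidAlgebra.lift ℂ A ℤ ((Units.coeHom A).comp (zpowersHom Aˣ a))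

lemma laurentLift_apply {A : Type*} [Ring A] [Algebra ℂ A] (a : Aˣ) (p : ℂ[T;T⁻¹]) :
    laurentLift a p = p.coeff.sum fun k c => c • (a ^ k).val := by
  rw [laurentLift, AddMonoidAlgebra.lift_apply]
  simp [zpowersHom_apply]

lemma laurentLift_T_one {A : Type*} [Ring A] [Algebra ℂ A] (a : Aˣ) :
    laurentLift a (LaurentPolynomial.T 1) = a := by
  rw [laurentLift, LaurentPolynomial.T, AddMonoidAlgebra.lift_single]
  simp [zpowersHom_apply]

/-- Algebra maps out of the group algebra of `ℤ` are monoid maps out of `ℤ`, which are fixed by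
their value at the generator. -/
lemma eq_laurentLift {A : Type*} [Ring A] [Algebra ℂ A] {a : Aˣ} {Φ : ℂ[T;T⁻¹] →ₐ[ℂ] A}
    (hΦ : Φ (LaurentPolynomial.T 1) = a) : Φ = laurentLift a := by
  refine (AddMonoidAlgebra.lift ℂ A ℤ).symm.injective (MonoidHom.ext_mint ?_)
  rw [AddMonoidAlgebra.lift_symm_apply, AddMonoidAlgebra.lift_symm_apply]
  exact hΦ.trans (laurentLift_T_one a).symm

/-- The structure of the Hecke algebra when the intertwining elements lie in the cosets of the
powers of a central element. -/
theorem exists_unit_heckeAlgebra [Nontrivial (Module.Dual ℂ V)] (hμ : μ (K : Set G) = 1) {z : G}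
    (hzc : z ∈ Subgroup.center G) (hz : ∀ k : ℤ, z ^ k ∈ K → k = 0)
    (hI : ∀ g, Intertwines K ρ g → ∃ k : ℤ, g * (z ^ k)⁻¹ ∈ K)
    (hS : ∀ T : V →ₗ[ℂ] V, (∀ k v, T (ρ k v) = ρ k (T v)) → ∃ c : ℂ, T = c • LinearMap.id) :
    ∃ α : (HeckeAlgebra K ρ μ)ˣ,
      (Function.support α.val = (K : Set G) * {z} ∧ α.val z = 1) ∧
      (∀ β : HeckeAlgebra K ρ μ, Function.support β = (K : Set G) * {z} → β z = 1 → β = α.val) ∧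
      (∀ k : ℤ, (α ^ k).val (z ^ k) = 1 ∧
        Function.support (α ^ k).val = (K : Set G) * {z ^ k} * (K : Set G) ∧
        Function.support (α ^ k).val = (K : Set G) * {z ^ k} ∧
        Function.support (α ^ k).val = {z ^ k} * (K : Set G)) ∧
      Algebra.adjoin ℂ {α.val, α⁻¹.val} = (⊤ : Subalgebra ℂ (HeckeAlgebra K ρ μ)) ∧
      (∃! Φ : ℂ[T;T⁻¹] →ₐ[ℂ] HeckeAlgebra K ρ μ, Φ (LaurentPolynomial.T 1) = α.val) ∧
      (∀ Φ : ℂ[T;T⁻¹] →ₐ[ℂ] HeckeAlgebra K ρ μ,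
        Φ (LaurentPolynomial.T 1) = α.val → Function.Bijective Φ) := by
  let w : Subgroup.center G := ⟨z, hzc⟩
  have hgen := exists_eq_sum_smul_zpow (ρ := ρ) hμ w hz hI hS
  refine ⟨centralUnit hμ w, ⟨support_centralFun K ρ z, centralFun_self K ρ z⟩,
    fun β hs h1 => ?_, fun k => ?_, ?_, ⟨laurentLift _, laurentLift_T_one _,
      fun Φ hΦ => eq_laurentLift hΦ⟩, fun Φ hΦ => ?_⟩
  · have := HeckeAlgebra.eq_smul_centralHom μ K ρ hμ β w (c := 1) hs.le (by simpa using h1)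
    rw [this, one_smul]
    rfl
  · have hk : z ^ k ∈ Subgroup.center G := Subgroup.zpow_mem _ hzc k
    rw [coe_centralUnit_zpow, support_centralFun, mul_singleton_mul_self hk]
    exact ⟨centralFun_self K ρ _, rfl, rfl, mul_singleton_eq_singleton_mul hk⟩
  · refine eq_top_iff.mpr fun f _ => ?_
    obtain ⟨p, rfl⟩ := hgen f
    have h1 : (centralUnit (ρ := ρ) hμ w).val ∈ Algebra.adjoin ℂ
        {(centralUnit (ρ := ρ) hμ w).val, (centralUnit (ρ := ρ) hμ w)⁻¹.val} :=
      Algebra.subset_adjoin (by simp)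
    have h2 : (centralUnit (ρ := ρ) hμ w)⁻¹.val ∈ Algebra.adjoin ℂ
        {(centralUnit (ρ := ρ) hμ w).val, (centralUnit (ρ := ρ) hμ w)⁻¹.val} :=
      Algebra.subset_adjoin (by simp)
    refine Subalgebra.sum_mem _ fun k _ => Subalgebra.smul_mem _ ?_ _
    obtain ⟨m, rfl | rfl⟩ := k.eq_nat_or_neg
    · rw [zpow_natCast, Units.val_pow_eq_pow_val]
      exact pow_mem h1 m
    · rw [zpow_neg, zpow_natCast, ← inv_pow, Units.val_pow_eq_pow_val]
      exact pow_mem h2 m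
  · obtain rfl := eq_laurentLift hΦ
    constructor
    · refine (injective_iff_map_eq_zero _).mpr fun p hp => LaurentPolynomial.ext fun m => ?_
      rw [laurentLift_apply] at hp
      -- Evaluation at `z ^ m` reads off the `m`-th coefficient, whence injectivity.
      have h1 := sum_smul_centralUnit_zpow_apply (ρ := ρ) hμ w hz p.coeff (z ^ m) m (by simp [w])
      rw [hp, centralFun_self] at h1
      exact (smul_eq_zero.mp h1.symm).resolve_right one_ne_zero
    · intro f
      obtain ⟨p, rfl⟩ := hgen f
      exact ⟨.ofCoeff p, laurentLift_apply _ _⟩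

end Laurent

/-! ### Rank normal form and cuspidality over a field. -/

section Linear

lemma exists_mul_mul_eq_diagonal {k : Type*} [Field k] {n : ℕ} (M : Matrix (Fin n) (Fin n) k) :
    ∃ A B : GL (Fin n) k, A.val * M * B.val =
      Matrix.diagonal fun i : Fin n => if i.val < M.rank then (1 : k) else 0 := by
  obtain ⟨P, Q, e, hP, hQ, h⟩ := M.exists_rank_normal_form
  have hr : M.rank ≤ n := by simpa using M.rank_le_card_width
  have hc : M.rank + (Fintype.card (Fin n) - M.rank) = n := by simp [hr]
  -- This reordering puts the ones in the first `M.rank` positions, matching the blocks of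
  -- `InUnipotentRadical`.
  let f : Fin n ≃ Fin n := ((finCongr hc).symm.trans finSumFinEquiv.symm).trans e.symm
  obtain ⟨P, rfl⟩ := hP
  obtain ⟨Q, rfl⟩ := hQ
  refine ⟨⟨P.val.submatrix f id, P⁻¹.val.submatrix id f, ?_, ?_⟩,
    ⟨Q.val.submatrix id f, Q⁻¹.val.submatrix f id, ?_, ?_⟩, ?_⟩
  · rw [← Matrix.submatrix_mul _ _ _ _ _ Function.bijective_id, Units.mul_inv,
      Matrix.submatrix_one _ f.injective]
  · rw [← Matrix.submatrix_mul _ _ _ _ _ f.bijective, Units.inv_mul, Matrix.submatrix_id_id]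
  · rw [← Matrix.submatrix_mul _ _ _ _ _ f.bijective, Units.mul_inv, Matrix.submatrix_id_id]
  · rw [← Matrix.submatrix_mul _ _ _ _ _ Function.bijective_id, Units.inv_mul,
      Matrix.submatrix_one _ f.injective]
  · have e1 : P.val.submatrix f id * M * Q.val.submatrix id f =
        (P.val * M * Q.val).submatrix f f := by
      ext i j
      simp [Matrix.mul_apply]
    change P.val.submatrix f id * M * Q.val.submatrix id f = _
    rw [e1, h, ← Matrix.diagonal_one, ← Matrix.diagonal_zero, Matrix.fromBlocks_diagonal,
      Matrix.submatrix_diagonal_equiv, Matrix.submatrix_diagonal_equiv]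
    congr 1
    funext i
    have : e (f i) = finSumFinEquiv.symm ((finCongr hc).symm i) := by simp [f]
    simp only [Function.comp_apply, this]
    obtain ⟨s, hs⟩ := finSumFinEquiv.surjective ((finCongr hc).symm i)
    have hv : (finSumFinEquiv s).val = i.val := by rw [hs]; rfl
    rw [← hs, Equiv.symm_apply_apply, ← hv]
    rcases s with s | s <;> simp

/-- A vector fixed by all unipotent elements `1 + M Y` with `Y M = 0` vanishes, when `τ` is
cuspidal and `M` is neither zero nor invertible. -/
lemma IsCuspidal.eq_zero_of_fixed {k : Type*} [Field k] {n : ℕ} {V : Type*} [AddCommGroup V]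
    [Module ℂ V] {τ : Representation ℂ (GL (Fin n) k) V} (hτ : IsCuspidal τ)
    {M : Matrix (Fin n) (Fin n) k} (hM : M ≠ 0) (hM' : ¬ IsUnit M) {v : V}
    (hv : ∀ (u : GL (Fin n) k) (Y : Matrix (Fin n) (Fin n) k),
      u.val = 1 + M * Y → Y * M = 0 → τ u v = v) : v = 0 := by
  obtain ⟨A, B, h⟩ := exists_mul_mul_eq_diagonal M
  have hM1 : M = A⁻¹.val * (A.val * M * B.val) * B⁻¹.val := by
    simp [mul_assoc]
  have h0 : 0 < M.rank := by
    by_contra h0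
    refine hM ?_
    have e : (Matrix.diagonal fun i : Fin n => if i.val < M.rank then (1 : k) else 0) = 0 := by
      rw [← Matrix.diagonal_zero]
      congr 1
      funext i
      exact if_neg fun h => h0 (Nat.zero_lt_of_lt h)
    rw [hM1, h, e, mul_zero, zero_mul]
  have hn : M.rank < n := by
    by_contra hn
    refine hM' ?_
    have e : (Matrix.diagonal fun i : Fin n => if i.val < M.rank then (1 : k) else 0) = 1 := by
      rw [← Matrix.diagonal_one]
      congr 1
      funext i
      exact if_pos (i.2.trans_le (not_lt.mp hn))
    rw [hM1, h, e]
    exact ((A⁻¹).isUnit.mul isUnit_one).mul (B⁻¹).isUnit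
  -- Write `AMB = D` and let `X = u - 1` for `u` in the standard radical, so that `DX = X` and `XD =
  -- 0`. With `Y = BXA` one gets `A⁻¹uA = 1 + MY` and `YM = 0`, so `τ A v` is fixed by the standard
  -- radical.
  have hA : τ A v = 0 := by
    refine hτ M.rank h0 hn _ fun u hu => ?_
    set D : Matrix (Fin n) (Fin n) k :=
      Matrix.diagonal fun i : Fin n => if i.val < M.rank then (1 : k) else 0 with hD
    have hX : ∀ i j : Fin n, ¬ (i.val < M.rank ∧ M.rank ≤ j.val) → (u.val - 1) i j = 0 :=
      fun i j hij => by rw [Matrix.sub_apply, hu i j hij, sub_self]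
    have h1 : D * (u.val - 1) = u.val - 1 := by
      ext i j
      rw [hD, Matrix.diagonal_mul]
      split_ifs with hi
      · rw [one_mul]
      · rw [hX i j fun h' => hi h'.1, mul_zero]
    have h2 : (u.val - 1) * D = 0 := by
      ext i j
      rw [hD, Matrix.mul_diagonal]
      split_ifs with hj
      · rw [hX i j fun h' => absurd hj (not_lt.mpr h'.2), zero_mul, Matrix.zero_apply]
      · rw [mul_zero, Matrix.zero_apply]
    have key := hv (A⁻¹ * u * A) (B.val * (u.val - 1) * A.val) ?_ ?_
    · have := congrArg (τ A) key
      rw [← Module.End.mul_apply, ← map_mul] at this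
      rw [← Module.End.mul_apply, ← map_mul, ← this]
      congr 2
      group
    · have : M * (B.val * (u.val - 1) * A.val) = A⁻¹.val * (D * (u.val - 1)) * A.val := by
        rw [← h]
        simp [← mul_assoc]
      rw [this, h1]
      simp [mul_sub, sub_mul]
    · have : B.val * (u.val - 1) * A.val * M = B.val * ((u.val - 1) * D) * B⁻¹.val := by
        rw [← h]
        simp [mul_assoc]
      rw [this, h2]
      simp
  have := congrArg (τ A⁻¹) hA
  rwa [← Module.End.mul_apply, ← map_mul, inv_mul_cancel, map_one, map_zero] at this

end Linear

/-! ### Lifting invertible matrices from the residue field. -/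

section LocalRing

variable {R : Type*} [CommRing R] [IsLocalRing R] {n : ℕ}

/-- Invertibility is detected by the determinant, and the residue map is a local homomorphism. -/
lemma isUnit_of_isUnit_map_residue {M : Matrix (Fin n) (Fin n) R}
    (h : IsUnit ((IsLocalRing.residue R).mapMatrix M)) : IsUnit M := by
  rw [Matrix.isUnit_iff_isUnit_det] at h ⊢
  rw [← RingHom.map_det] at h
  exact isUnit_of_map_unit _ _ h

lemma mapMatrix_residue_surjective :
    Function.Surjective ((IsLocalRing.residue R).mapMatrix (m := Fin n)) := by
  intro M
  choose f hf using fun i j => IsLocalRing.residue_surjective (M i j)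
  exact ⟨Matrix.of f, by ext i j; exact hf i j⟩

lemma map_residue_surjective :
    Function.Surjective (Matrix.GeneralLinearGroup.map (n := Fin n) (IsLocalRing.residue R)) := by
  intro u
  obtain ⟨M, hM⟩ := mapMatrix_residue_surjective u.val
  obtain ⟨m, rfl⟩ := isUnit_of_isUnit_map_residue (M := M) (by rw [hM]; exact u.isUnit)
  exact ⟨m, Units.ext hM⟩

end LocalRing

/-! ### The intertwining set of an inflated cuspidal representation. -/

section Intertwining

set_option linter.unusedSectionVars false

variable {F E : Type*} [Field F] [Field E] [Algebra F E] [Algebra.IsQuadraticExtension F E]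
  [ValuativeRel E]

/-- The central element `diag(c 1_n, c̄⁻¹ 1_n)` of `L`. -/
def scalarElt (n : ℕ) (σ : E ≃ₐ[F] E) : Eˣ →* levi n σ :=
  (leviEquiv n σ).toMonoidHom.comp (Units.map (Matrix.scalar (Fin n)).toMonoidHom)

lemma scalarElt_mem_center (n : ℕ) (σ : E ≃ₐ[F] E) (c : Eˣ) :
    scalarElt n σ c ∈ Subgroup.center (levi n σ) := by
  rw [Subgroup.mem_center_iff]
  intro g
  obtain ⟨a, rfl⟩ := (leviEquiv n σ).surjective g
  change leviEquiv n σ a * leviEquiv n σ _ = leviEquiv n σ _ * leviEquiv n σ a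
  rw [← map_mul, ← map_mul]
  congr 1
  ext1
  exact (Matrix.scalar_commute c.val (fun r => mul_comm _ _) a.val).eq.symm

lemma intHom_mem_P0 (n : ℕ) (σ : E ≃ₐ[F] E) (a : GL (Fin n) 𝒪[E]) : intHom n σ a ∈ P0 n σ :=
  ⟨a, rfl⟩

lemma reduction_intHom (n : ℕ) (σ : E ≃ₐ[F] E) (a : GL (Fin n) 𝒪[E])
    (h : intHom n σ a ∈ P0 n σ) :
    reduction n σ ⟨intHom n σ a, h⟩ =
      Matrix.GeneralLinearGroup.map (IsLocalRing.residue 𝒪[E]) a := by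
  have : (MonoidHom.ofInjective (intHom_injective n σ)).symm ⟨intHom n σ a, h⟩ = a :=
    (MonoidHom.ofInjective (intHom_injective n σ)).symm_apply_apply a
  change Matrix.GeneralLinearGroup.map _
    ((MonoidHom.ofInjective (intHom_injective n σ)).symm ⟨intHom n σ a, h⟩) = _
  rw [this]

lemma reduction_surjective (n : ℕ) (σ : E ≃ₐ[F] E) : Function.Surjective (reduction n σ) := by
  intro u
  obtain ⟨a, rfl⟩ := map_residue_surjective u
  exact ⟨⟨intHom n σ a, intHom_mem_P0 n σ a⟩, reduction_intHom n σ a _⟩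

/-- Every invertible matrix is a scalar multiple of an integral matrix with nonzero reduction. -/
lemma exists_eq_smul_integral {n : ℕ} (hn : 0 < n) (a : GL (Fin n) E) :
    ∃ (c : Eˣ) (M : Matrix (Fin n) (Fin n) 𝒪[E]),
      a.val = c.val • 𝒪[E].subtype.mapMatrix M ∧
        (IsLocalRing.residue 𝒪[E]).mapMatrix M ≠ 0 := by
  have : Nonempty (Fin n) := ⟨⟨0, hn⟩⟩
  -- Dividing by an entry of maximal valuation makes the matrix integral and turns that entry into
  -- `1`, which survives reduction.
  obtain ⟨⟨i, j⟩, hij⟩ := Finite.exists_max fun q : Fin n × Fin n =>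
    valuation E (a.val q.1 q.2)
  have h0 : a.val i j ≠ 0 := by
    intro h0
    refine a.ne_zero (Matrix.ext fun r s => ?_)
    have := hij (r, s)
    simpa [h0] using this
  have hint : ∀ r s, (a.val i j)⁻¹ * a.val r s ∈ 𝒪[E] := by
    intro r s
    rw [Valuation.mem_integer_iff, map_mul, map_inv₀]
    rw [inv_mul_le_one₀ (zero_lt_iff.mpr ((Valuation.ne_zero_iff _).mpr h0))]
    exact hij (r, s)
  refine ⟨Units.mk0 _ h0, Matrix.of fun r s => ⟨_, hint r s⟩, ?_, fun h => ?_⟩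
  · ext r s
    simp [mul_inv_cancel_left₀ h0]
  · have h1 := congrFun (congrFun h i) j
    have h2 : (⟨(a.val i j)⁻¹ * a.val i j, hint i j⟩ : 𝒪[E]) = 1 :=
      Subtype.ext (inv_mul_cancel₀ h0)
    simp [h2] at h1

/-- The heart of the proof: when the reduction of the primitive integral part `M` is singular, every
vector in the image of an intertwining operator is fixed by a unipotent radical, hence zero. -/
lemma Intertwines.exists_scalarElt_mul {n : ℕ} (hn : 0 < n) {σ : E ≃ₐ[F] E} {V : Type*}
    [AddCommGroup V] [Module ℂ V] {τ : Representation ℂ (GL (Fin n) 𝓀[E]) V}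
    (hτ : IsCuspidal τ) {g : levi n σ} (hg : Intertwines (P0 n σ) (inflate n σ τ) g) :
    ∃ (c : Eˣ) (p : P0 n σ), g = scalarElt n σ c * p := by
  obtain ⟨a, rfl⟩ := (leviEquiv n σ).surjective g
  obtain ⟨c, M, hM, hM0⟩ := exists_eq_smul_integral hn a
  by_cases hu : IsUnit ((IsLocalRing.residue 𝒪[E]).mapMatrix M)
  · obtain ⟨m, rfl⟩ := isUnit_of_isUnit_map_residue hu
    refine ⟨c, ⟨intHom n σ m, intHom_mem_P0 n σ m⟩, ?_⟩
    change leviEquiv n σ a = leviEquiv n σ _ * leviEquiv n σ _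
    rw [← map_mul]
    congr 1
    ext1
    rw [hM, Units.val_mul]
    exact Matrix.smul_eq_diagonal_mul _ _
  · obtain ⟨T, hT, hT'⟩ := hg
    refine absurd (LinearMap.ext fun v => ?_) hT
    refine hτ.eq_zero_of_fixed hM0 hu fun u Y hY hY' => ?_
    obtain ⟨Y, rfl⟩ := mapMatrix_residue_surjective Y
    have hx : (IsLocalRing.residue 𝒪[E]).mapMatrix (1 + M * Y) = u.val := by
      rw [hY, map_add, map_mul, map_one]
    have hy : (IsLocalRing.residue 𝒪[E]).mapMatrix (1 + Y * M) = 1 := by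
      rw [map_add, map_mul, map_one, hY', add_zero]
    obtain ⟨x, hx'⟩ := isUnit_of_isUnit_map_residue (by rw [hx]; exact u.isUnit)
    obtain ⟨y, hy'⟩ := isUnit_of_isUnit_map_residue (by rw [hy]; exact isUnit_one)
    -- With `x = 1 + MY` and `y = 1 + YM` both sides are `M + MYM`. The scalar `c` drops out of the
    -- conjugation in `e'`.
    have e : M * y.val = x.val * M := by
      rw [hx', hy']; noncomm_ring
    have e' : (leviEquiv n σ a)⁻¹ * intHom n σ x * leviEquiv n σ a = intHom n σ y := by
      rw [mul_assoc, inv_mul_eq_iff_eq_mul]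
      change leviEquiv n σ _ * leviEquiv n σ _ = leviEquiv n σ _ * leviEquiv n σ _
      rw [← map_mul, ← map_mul]
      congr 1
      ext1
      rw [Units.val_mul, Units.val_mul, hM, mul_smul_comm, smul_mul_assoc]
      congr 1
      have := congrArg 𝒪[E].subtype.mapMatrix e
      rw [map_mul, map_mul] at this
      exact this.symm
    have key := hT' (intHom n σ x) (intHom_mem_P0 n σ x)
      (by rw [e']; exact intHom_mem_P0 n σ y) v
    simp only [e', inflate, MonoidHom.comp_apply] at key
    rw [reduction_intHom, reduction_intHom] at key
    have rx : Matrix.GeneralLinearGroup.map (IsLocalRing.residue 𝒪[E]) x = u :=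
      Units.ext (by rw [← hx, ← hx']; rfl)
    have ry : Matrix.GeneralLinearGroup.map (IsLocalRing.residue 𝒪[E]) y = 1 :=
      Units.ext (by rw [Units.val_one, ← hy, ← hy']; rfl)
    -- Since `y` reduces to `1` and `x` to `u`, the intertwining relation becomes `T v = τ u (T v)`.
    rw [rx, ry, map_one] at key
    exact key.symm

end Intertwining

/-! ### Powers of the uniformizer and scalar elements of `𝔓₀`. -/

section Uniformizer

variable {F E : Type*} [Field F] [Field E] [Algebra F E] [Algebra.IsQuadraticExtension F E]
  [ValuativeRel E]

/-- If `k ≠ 0`, a negative power of `ϖ` would be integral and the irreducible `p` a unit. This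
separates the cosets of the powers of `ζ`. -/
lemma IsUniformizer.zpow_mem {ϖ : Eˣ} (hϖ : IsUniformizer ϖ) {k : ℤ}
    (h1 : ((ϖ ^ k : Eˣ) : E) ∈ 𝒪[E]) (h2 : ((ϖ ^ (-k) : Eˣ) : E) ∈ 𝒪[E]) : k = 0 := by
  obtain ⟨p, hp, hpϖ⟩ := hϖ
  by_contra hk
  have key : ∀ m : ℕ, m ≠ 0 → ((ϖ ^ (-(m : ℤ)) : Eˣ) : E) ∈ 𝒪[E] → False := by
    intro m hm h
    refine hp.not_isUnit ((isUnit_pow_iff hm).mp (IsUnit.of_mul_eq_one (⟨_, h⟩ : 𝒪[E]) ?_))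
    ext
    simp [hpϖ]
  obtain ⟨m, rfl | rfl⟩ := k.eq_nat_or_neg
  · exact key m (by simpa using hk) h2
  · exact key m (by simpa using hk) h1

/-- Factorisation in the discrete valuation ring `𝒪[E]`, applied to `c` or to `c⁻¹`, one of which is
integral. -/
lemma IsUniformizer.exists_eq_zpow_mul [TopologicalSpace E] [IsNonarchimedeanLocalField E]
    {ϖ : Eˣ} (hϖ : IsUniformizer ϖ) (c : Eˣ) :
    ∃ (k : ℤ) (u : 𝒪[E]ˣ), c = ϖ ^ k * Units.map 𝒪[E].subtype.toMonoidHom u := by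
  obtain ⟨p, hp, hpϖ⟩ := hϖ
  have key : ∀ c : Eˣ, (c : E) ∈ 𝒪[E] →
      ∃ (k : ℤ) (u : 𝒪[E]ˣ), c = ϖ ^ k * Units.map 𝒪[E].subtype.toMonoidHom u := by
    intro c hc
    obtain ⟨m, u, hu⟩ := IsDiscreteValuationRing.eq_unit_mul_pow_irreducible
      (x := (⟨c, hc⟩ : 𝒪[E])) (fun h => c.ne_zero (congrArg Subtype.val h)) hp
    refine ⟨m, u, Units.ext ?_⟩
    have := congrArg (Subtype.val : 𝒪[E] → E) hu
    simpa [hpϖ, mul_comm] using this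
  rcases le_total (valuation E c.val) 1 with h | h
  · exact key c h
  · obtain ⟨k, u, hu⟩ := key c⁻¹ (by
      rw [Valuation.mem_integer_iff, Units.val_inv_eq_inv_val, map_inv₀]
      exact inv_le_one_of_one_le₀ h)
    exact ⟨-k, u⁻¹, by rw [← inv_inv c, hu, mul_inv, zpow_neg, map_inv]⟩

lemma mem_integers_of_scalarElt_mem_P0 [TopologicalSpace E] [IsNonarchimedeanLocalField E]
    {n : ℕ} (hn : 0 < n) {σ : E ≃ₐ[F] E} {c : Eˣ}
    (h : scalarElt n σ c ∈ P0 n σ) : (c : E) ∈ 𝒪[E] := by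
  have h1 := ((mem_P0_iff n σ _).mp h).1 ⟨0, hn⟩ ⟨0, hn⟩
  change Matrix.scalar (Fin n) c.val ⟨0, hn⟩ ⟨0, hn⟩ ∈ 𝒪[E] at h1
  simpa using h1

lemma scalarElt_unit_mem_P0 (n : ℕ) (σ : E ≃ₐ[F] E) (u : 𝒪[E]ˣ) :
    scalarElt n σ (Units.map 𝒪[E].subtype.toMonoidHom u) ∈ P0 n σ := by
  refine ⟨Units.map (Matrix.scalar (Fin n)).toMonoidHom u, ?_⟩
  change leviEquiv n σ _ = leviEquiv n σ _
  congr 1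
  ext i j
  change ((Matrix.scalar (Fin n) u.val i j : 𝒪[E]) : E) = Matrix.scalar (Fin n) (u.val : E) i j
  simp only [Matrix.scalar_apply, Matrix.diagonal_apply]
  split_ifs <;> rfl

end Uniformizer

end SiegelLevi

end

/-! ### The Hecke algebra of the Siegel Levi subgroup. -/

theorem mainTheorem7
    {F E : Type*} [Field F] [ValuativeRel F] [TopologicalSpace F] [IsNonarchimedeanLocalField F]
    [Field E] [ValuativeRel E] [TopologicalSpace E] [IsNonarchimedeanLocalField E]
    [Algebra F E] [ValuativeExtension F E] [Algebra.IsQuadraticExtension F E] [IsGalois F E]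
    (σ : E ≃ₐ[F] E) (hσ : σ ≠ AlgEquiv.refl)
    (n : ℕ) (hn : 0 < n)
    {V : Type*} [AddCommGroup V] [Module ℂ V] [FiniteDimensional ℂ V]
    (τ : Representation ℂ (GL (Fin n) 𝓀[E]) V) (hirr : τ.IsIrreducible)
    (hcusp : SiegelLevi.IsCuspidal τ)
    (ϖ : Eˣ) (hϖ : SiegelLevi.IsUniformizer ϖ)
    [MeasurableSpace (SiegelLevi.levi n σ)] [BorelSpace (SiegelLevi.levi n σ)]
    (μ : Measure (SiegelLevi.levi n σ)) [μ.IsHaarMeasure]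
    (hμ : μ (SiegelLevi.P0 n σ : Set (SiegelLevi.levi n σ)) = 1) :
    let L := SiegelLevi.levi n σ
    let P₀ : Subgroup L := SiegelLevi.P0 n σ
    let ρ₀ : Representation ℂ P₀ V := SiegelLevi.inflate n σ τ
    let H := SiegelLevi.HeckeAlgebra P₀ ρ₀ μ
    let ζ : L := SiegelLevi.zeta n σ ϖ
    -- the set of elements intertwining `ρ₀` is `Z(L) P₀`
    {g : L | SiegelLevi.Intertwines P₀ ρ₀ g} = (Subgroup.center L : Set L) * (P₀ : Set L) ∧
    -- products of elements supported on one coset of a central element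
    (∀ (φ₁ φ₂ : H) (z₁ z₂ : L) (c₁ c₂ : ℂ), z₁ ∈ Subgroup.center L → z₂ ∈ Subgroup.center L →
      Function.support φ₁ = (P₀ : Set L) * {z₁} → Function.support φ₂ = (P₀ : Set L) * {z₂} →
      φ₁ z₁ = c₁ • 1 → φ₂ z₂ = c₂ • 1 →
        (φ₁ * φ₂) (z₁ * z₂) = φ₁ z₁ * φ₂ z₂ ∧ (φ₁ * φ₂) (z₁ * z₂) = (c₁ * c₂) • 1 ∧
        Function.support (φ₁ * φ₂) = (P₀ : Set L) * {z₁ * z₂}) ∧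
    -- the element `α`, which exists uniquely and is invertible
    ∃ α : Hˣ,
      (Function.support α.val = (P₀ : Set L) * {ζ} ∧ α.val ζ = 1) ∧
      (∀ β : H, Function.support β = (P₀ : Set L) * {ζ} → β ζ = 1 → β = α.val) ∧
      -- its powers
      (∀ k : ℤ, (α ^ k).val (ζ ^ k) = 1 ∧
        Function.support (α ^ k).val = (P₀ : Set L) * {ζ ^ k} * (P₀ : Set L) ∧
        Function.support (α ^ k).val = (P₀ : Set L) * {ζ ^ k} ∧
        Function.support (α ^ k).val = {ζ ^ k} * (P₀ : Set L)) ∧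
      -- `H = ℂ[α, α⁻¹]`
      Algebra.adjoin ℂ {α.val, α⁻¹.val} = (⊤ : Subalgebra ℂ H) ∧
      -- the unique algebra homomorphism `ℂ[x, x⁻¹] → H`, `x ↦ α`, is an isomorphism
      (∃! Φ : ℂ[T;T⁻¹] →ₐ[ℂ] H, Φ (LaurentPolynomial.T 1) = α.val) ∧
      (∀ Φ : ℂ[T;T⁻¹] →ₐ[ℂ] H, Φ (LaurentPolynomial.T 1) = α.val → Function.Bijective Φ) := by
  have hint : ∀ g, SiegelLevi.Intertwines (SiegelLevi.P0 n σ) (SiegelLevi.inflate n σ τ) g →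
      ∃ (c : Eˣ) (p : SiegelLevi.P0 n σ), g = SiegelLevi.scalarElt n σ c * p :=
    fun _ hg => hg.exists_scalarElt_mul hn hcusp
  have : Nontrivial V := by
    by_contra h
    rw [not_nontrivial_iff_subsingleton] at h
    exact bot_ne_top (α := Subrepresentation τ) (SetLike.ext fun v => by
      rw [Subsingleton.elim v 0]
      exact iff_of_true (zero_mem (⊥ : Subrepresentation τ).toSubmodule)
        (zero_mem (⊤ : Subrepresentation τ).toSubmodule))
  have : Nontrivial (Module.Dual ℂ V) := inferInstance
  refine ⟨?_, SiegelLevi.mul_of_support_eq μ _ _ hμ, SiegelLevi.exists_unit_heckeAlgebra hμ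
    (SiegelLevi.scalarElt_mem_center n σ ϖ) (fun k hk => ?_) (fun g hg => ?_) fun T hT => ?_⟩
  · ext g
    constructor
    · intro hg
      obtain ⟨c, p, rfl⟩ := hint g hg
      exact Set.mul_mem_mul (SiegelLevi.scalarElt_mem_center n σ c) p.2
    · rintro ⟨z, hz, p, hp, rfl⟩
      exact SiegelLevi.intertwines_mul hz hp
  -- Membership of `ζ ^ k` and of its inverse in `𝔓₀` makes both `ϖ ^ k` and `ϖ ^ (-k)` integral, so
  -- `k = 0`.
  · have hk' := inv_mem hk
    change SiegelLevi.scalarElt n σ ϖ ^ k ∈ _ at hk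
    change (SiegelLevi.scalarElt n σ ϖ ^ k)⁻¹ ∈ _ at hk'
    rw [← map_zpow] at hk hk'
    rw [← map_inv, ← zpow_neg] at hk'
    exact hϖ.zpow_mem (SiegelLevi.mem_integers_of_scalarElt_mem_P0 hn hk)
      (SiegelLevi.mem_integers_of_scalarElt_mem_P0 hn hk')
  · obtain ⟨c, p, rfl⟩ := hint g hg
    -- The scalar is `ϖ ^ k` times a unit of `𝒪[E]`, and the unit is absorbed into `𝔓₀`.
    obtain ⟨k, u, rfl⟩ := hϖ.exists_eq_zpow_mul c
    refine ⟨k, ?_⟩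
    change _ * (SiegelLevi.scalarElt n σ ϖ ^ k)⁻¹ ∈ _
    have hc := Subgroup.mem_center_iff.mp
      (inv_mem (SiegelLevi.scalarElt_mem_center n σ (ϖ ^ k)))
    rw [← map_zpow, hc, map_mul, mul_assoc, inv_mul_cancel_left]
    exact mul_mem (SiegelLevi.scalarElt_unit_mem_P0 n σ u) p.2
  -- Reduction is surjective, so commuting with the inflation amounts to commuting with `τ`, where
  -- Schur's lemma applies.
  · refine SiegelLevi.exists_eq_smul_of_commute hirr T fun u v => ?_
    obtain ⟨k, rfl⟩ := SiegelLevi.reduction_surjective n σ u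
    exact hT k v
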